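/- **Setting.** Let $E$ be a Radon topological space (homeomorphic to a universally measurable subspace of a compact metric space) with its Borel $\sigma$-algebra, and let $m$ be a $\sigma$-finite Radon measure on $E$. Let $Y=(\Omega',\mathcal F',\mathcal F'_t,Y_t,\mathbb P^0_x)$ be a right process on $E$ (with infinite lifetime): a right-continuous Markov process for which $x\mapsto\mathbb P^0_x(A)$ is universally measurable for each $A\in\mathcal F'$, $\mathbb P_x^0(Y_0=x)=1$, and $t\mapsto f(Y_t)$ is almost surely right-continuous, under every initial distribution, for every $\alpha>0$ and every $\alpha$-excessive function $f$. Write $\mathbb P^0_\nu=\int\nu(dx)\,\mathbb P^0_x$. Let $\kappa:E\to[0,\infty)$ be measurable and locally bounded, and let $\mu$ be a probability measure on $E$. **Restore process.** Put $\tau_\partial=\inf\{t\ge0:\int_0^t\kappa(Y_s)\,ds\ge\xi\}$ (with $\inf\varnothing=\infty$), where $\xi\sim\mathrm{Exp}(1)$ is independent of $Y$. For a probability measure $\nu$ on $E$, let $(Y^{(0)},\tau^{(0)})$ be a copy of $(Y,\tau_\partial)$ under $\mathbb P^0_\nu$ and, independently of it, let $(Y^{(i)},\tau^{(i)})_{i\ge1}$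 be i.i.d. copies of $(Y,\tau_\partial)$ under $\mathbb P^0_\mu$. Put $T_n=\sum_{i<n}\tau^{(i)}$ and $$X_t=Y^{(i)}_{t-T_i}\qquad\text{for } T_i\le t<T_{i+1}.$$ This is the Restore process with interarrival dynamics $Y$, regeneration rate $\kappa$, regeneration distribution $\mu$ and initial distribution $\nu$. Denote by $\nu P_t^\mu$ the distribution of $X_t$. A probability measure $\pi$ is *invariant* if $\pi P_t^\mu=\pi$ for all $t\ge0$. The process $X$ is *irreducible* if there is a nonzero $\sigma$-finite measure $\varphi$ on $E$ such that $\varphi(B)>0$ implies $\int_0^\infty\delta_xP_t^\mu(B)\,dt>0$ for every $x\in E$. For probability measures write $$\|\rho_1-\rho_2\|_{TV}=\sup\{|\rho_1(f)-\rho_2(f)|: f \text{ measurable},\ \|f\|_\infty\le1\}.$$ **Proposition (Uniform ergodicity).** Assume that $X$ is irreducible and that there is a constant $\underline\kappa>0$ such that $\kappa\ge\underline\kappa$ $m$-almost everywhere. Assume also that $Y$ spends no time in the exceptional set: for every $x\in E$, $\mathbb P^0_x$-almost surely, $\kappa(Y_s)\ge\underline\kappa$ for Lebesgue-almost every $s\ge0$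 (this is automatic if $\kappa\ge\underline\kappa$ everywhere, or if the occupation measures $\int_0^\infty\mathbb P^0_x(Y_s\in\cdot)\,ds$ do not charge $m$-null sets). Then $X$ has a unique invariant distribution $\pi$, and $$\|\nu P_t^\mu-\pi\|_{TV}\le 2e^{-t\underline\kappa}$$ for every initial distribution $\nu$ and every $t\ge0$. -/

import Mathlib

open MeasureTheory ProbabilityTheory Filter Topology
open scoped NNReal ENNReal

noncomputable section

namespace Restore

/-! ### Universal measurability and Radon spaces -/

/-- The universal completion of a σ-algebra: the sets that are measurable for the completion of
every finite measure. -/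
@[reducible] def universalCompletion (α : Type*) [MeasurableSpace α] : MeasurableSpace α where
  MeasurableSet' s := ∀ ν : Measure α, IsFiniteMeasure ν → NullMeasurableSet s ν
  measurableSet_empty := fun _ _ => nullMeasurableSet_empty
  measurableSet_compl := fun _ hs ν hν => (hs ν hν).compl
  measurableSet_iUnion := fun _ hs ν hν => NullMeasurableSet.iUnion fun i => hs i ν hν

lemma aemeasurable_of_universal {α : Type*} [MeasurableSpace α] {f : α → ℝ≥0∞}
    (hf : Measurable[universalCompletion α] f) (ν : Measure α) [IsFiniteMeasure ν] :
    AEMeasurable f ν := by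
  have h : NullMeasurable f ν := fun s hs => hf hs ν inferInstance
  exact h.aemeasurable

/-- A Radon topological space: a space homeomorphic to a universally measurable subspace of a
compact metrizable space. -/
def IsRadonSpace.{u} (E : Type u) [TopologicalSpace E] : Prop :=
  ∃ (K : Type u) (_ : TopologicalSpace K) (_ : CompactSpace K)
    (_ : TopologicalSpace.MetrizableSpace K) (i : E → K),
    IsEmbedding i ∧ MeasurableSet[@universalCompletion K (borel K)] (Set.range i)

/-! ### Right processes -/

/-- A right-continuous Markov process `(Ω, 𝓕, 𝓕_t, Y_t, P_x)` on a Radon space `E` with its Borel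
σ-algebra. The probabilities `P_x(A)` are universally measurable in `x`; the transition semigroup
is `P_t(x, B) = P_x(Y_t ∈ B)`. -/
structure RCMarkovProcess (E Ω : Type*) [TopologicalSpace E] [MeasurableSpace E]
    [mΩ : MeasurableSpace Ω] where
  /-- the filtration `𝓕_t` -/
  filtration : Filtration ℝ≥0 mΩ
  /-- the process `Y_t(ω)` -/
  path : ℝ≥0 → Ω → E
  /-- the law `P_x` of the process started at `x` -/
  law : E → Measure Ω
  isProbability : ∀ x, IsProbabilityMeasure (law x)
  measurable_law : ∀ A : Set Ω, MeasurableSet A →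
    Measurable[universalCompletion E] (fun x => law x A)
  radon : IsRadonSpace E
  adapted : ∀ t, Measurable[filtration t] (path t)
  rightContinuous : ∀ ω t, ContinuousWithinAt (fun s => path s ω) (Set.Ici t) t
  start : ∀ x, ∀ᵐ ω ∂(law x), path 0 ω = x
  /-- Markov property: `P_x(A, Y_{t+s} ∈ B) = E_x[1_A P_s(Y_t, B)]` for `A ∈ 𝓕_t`. -/
  markov : ∀ (x : E) (t s : ℝ≥0) (A : Set Ω) (B : Set E),
    MeasurableSet[filtration t] A → MeasurableSet B →
    law x (A ∩ path (t + s) ⁻¹' B) = ∫⁻ ω in A, law (path t ω) (path s ⁻¹' B) ∂(law x)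

namespace RCMarkovProcess

variable {E Ω : Type*} [TopologicalSpace E] [MeasurableSpace E] [MeasurableSpace Ω]

/-- `P_ν = ∫ ν(dx) P_x`, the law of the process with initial distribution `ν`. -/
def initLaw (Y : RCMarkovProcess E Ω) (ν : Measure E) [IsProbabilityMeasure ν] : Measure Ω :=
  Measure.ofMeasurable (fun A _ => ∫⁻ x, Y.law x A ∂ν) (by simp) (by
    intro A hA hd
    simp_rw [measure_iUnion hd hA]
    exact lintegral_tsum fun i => aemeasurable_of_universal (Y.measurable_law _ (hA i)) ν)

lemma initLaw_apply (Y : RCMarkovProcess E Ω) (ν : Measure E) [IsProbabilityMeasure ν]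
    {A : Set Ω} (hA : MeasurableSet A) : Y.initLaw ν A = ∫⁻ x, Y.law x A ∂ν :=
  Measure.ofMeasurable_apply A hA

instance (Y : RCMarkovProcess E Ω) (ν : Measure E) [IsProbabilityMeasure ν] :
    IsProbabilityMeasure (Y.initLaw ν) := by
  refine ⟨?_⟩
  have h : ∀ x, Y.law x Set.univ = 1 := fun x => (Y.isProbability x).measure_univ
  simp [initLaw_apply Y ν MeasurableSet.univ, h]

/-- `α`-excessive functions: universally measurable `f ≥ 0` with `e^{-αt} P_t f ≤ f` for all `t`
and `e^{-αt} P_t f → f` pointwise as `t ↓ 0`. -/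
def IsExcessive (Y : RCMarkovProcess E Ω) (α : ℝ) (f : E → ℝ≥0∞) : Prop :=
  Measurable[universalCompletion E] f ∧
  (∀ (t : ℝ≥0) (x : E),
    ENNReal.ofReal (Real.exp (-α * t)) * ∫⁻ ω, f (Y.path t ω) ∂(Y.law x) ≤ f x) ∧
  ∀ x : E, Tendsto
    (fun t : ℝ≥0 => ENNReal.ofReal (Real.exp (-α * t)) * ∫⁻ ω, f (Y.path t ω) ∂(Y.law x))
    (𝓝[>] 0) (𝓝 (f x))

end RCMarkovProcess

/-- A right process: a right-continuous Markov process such that `t ↦ f(Y_t)` is almost surely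
right-continuous, for every initial distribution, `α > 0` and `α`-excessive function `f`. -/
structure RightProcess (E Ω : Type*) [TopologicalSpace E] [MeasurableSpace E]
    [MeasurableSpace Ω] extends RCMarkovProcess E Ω where
  excessive_rightContinuous : ∀ (α : ℝ) (f : E → ℝ≥0∞), 0 < α →
    toRCMarkovProcess.IsExcessive α f →
    ∀ (ν : Measure E) [IsProbabilityMeasure ν], ∀ᵐ ω ∂(toRCMarkovProcess.initLaw ν),
      ∀ t : ℝ≥0, ContinuousWithinAt (fun s => f (path s ω)) (Set.Ici t) t

/-- `κ` is bounded in a neighbourhood of each point. -/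
def IsLocallyBounded {E : Type*} [TopologicalSpace E] (κ : E → ℝ≥0) : Prop :=
  ∀ x, ∃ U ∈ 𝓝 x, BddAbove (κ '' U)

/-! ### The Restore process -/

section Construction

variable {E Ω : Type*} [TopologicalSpace E] [MeasurableSpace E] [MeasurableSpace Ω]

/-- The sample space carrying the pairs `(Y^{(i)}, ξ^{(i)})`: the first component is the cycle
number `0`, the second one lists the cycles `1, 2, …`. -/
abbrev CycleSpace (Ω : Type*) := (Ω × ℝ) × (ℕ → Ω × ℝ)

/-- The `i`-th pair `(Y^{(i)}, ξ^{(i)})`. -/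
def cycle (w : CycleSpace Ω) : ℕ → Ω × ℝ
  | 0 => w.1
  | i + 1 => w.2 i

/-- The lifetime `τ = inf {t ≥ 0 : ∫_0^t κ(Y_s) ds ≥ ξ}`, with `inf ∅ = ∞`. -/
def lifetime (Y : RightProcess E Ω) (κ : E → ℝ≥0) (p : Ω × ℝ) : ℝ≥0∞ :=
  ⨅ (t : ℝ≥0) (_ : ENNReal.ofReal p.2 ≤
    ∫⁻ s in Set.Icc (0 : ℝ) t, (κ (Y.path s.toNNReal p.1) : ℝ≥0∞)), (t : ℝ≥0∞)

/-- The regeneration times `T_n = τ^{(0)} + ⋯ + τ^{(n-1)}`. -/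
def regenTime (Y : RightProcess E Ω) (κ : E → ℝ≥0) (n : ℕ) (w : CycleSpace Ω) : ℝ≥0∞ :=
  ∑ i ∈ Finset.range n, lifetime Y κ (cycle w i)

open Classical in
/-- The Restore process: `X_t = Y^{(i)}_{t - T_i}` if `T_i ≤ t < T_{i+1}`. (Such an `i` is unique;
outside of the null event `sup_n T_n ≤ t` it exists. On that event an arbitrary value is used.) -/
def restorePath (Y : RightProcess E Ω) (κ : E → ℝ≥0) (t : ℝ≥0) (w : CycleSpace Ω) : E :=
  if h : ∃ i, regenTime Y κ i w ≤ t ∧ (t : ℝ≥0∞) < regenTime Y κ (i + 1) w then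
    Y.path (t - (regenTime Y κ (Nat.find h) w).toNNReal) (cycle w (Nat.find h)).1
  else Y.path t (cycle w 0).1

/-- The law, for the Restore process with initial distribution `ν` and regeneration distribution
`μ`, of the cycles: they are independent, `Y^{(0)}` starts from `ν`, the other `Y^{(i)}` start
from `μ`, and each `ξ^{(i)}` is standard exponential and independent of `Y^{(i)}`. -/
def restoreMeasure (Y : RightProcess E Ω) (μ ν : Measure E)
    [IsProbabilityMeasure μ] [IsProbabilityMeasure ν] : Measure (CycleSpace Ω) :=
  ((Y.initLaw ν).prod (expMeasure 1)).prod
    (Measure.infinitePi fun _ : ℕ => (Y.initLaw μ).prod (expMeasure 1))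

/-- `ν P_t^μ`: the distribution of `X_t` when `X_0 ∼ ν`. -/
def restoreLaw (Y : RightProcess E Ω) (κ : E → ℝ≥0) (μ ν : Measure E)
    [IsProbabilityMeasure μ] [IsProbabilityMeasure ν] (t : ℝ≥0) : Measure E :=
  (restoreMeasure Y μ ν).map (restorePath Y κ t)

/-- `X` is irreducible: for some nonzero σ-finite measure `φ`, each set `B` with `φ(B) > 0` has
positive expected occupation time `∫_0^∞ P_x(X_t ∈ B) dt` from every starting point `x`. -/
def IsIrreducible (Y : RightProcess E Ω) (κ : E → ℝ≥0) (μ : Measure E)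
    [IsProbabilityMeasure μ] : Prop :=
  ∃ φ : Measure E, SigmaFinite φ ∧ φ ≠ 0 ∧ ∀ B : Set E, MeasurableSet B → 0 < φ B →
    ∀ x : E, 0 < ∫⁻ t in Set.Ici (0 : ℝ),
      restoreLaw Y κ μ (Measure.dirac x) t.toNNReal B

/-- `π` is an invariant distribution of `X`: `π P_t^μ = π` for all `t ≥ 0`. -/
def IsInvariantDistribution (Y : RightProcess E Ω) (κ : E → ℝ≥0) (μ π : Measure E)
    [IsProbabilityMeasure μ] [IsProbabilityMeasure π] : Prop :=
  ∀ t : ℝ≥0, restoreLaw Y κ μ π t = π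

end Construction

/-- The total variation norm of `ρ₁ - ρ₂`, i.e. the supremum of `|ρ₁(f) - ρ₂(f)|` over the
measurable `f` with `‖f‖_∞ ≤ 1`. -/
def tvNormSub {E : Type*} [MeasurableSpace E] (ρ₁ ρ₂ : Measure E) : ℝ≥0∞ :=
  ⨆ (f : E → ℝ) (_ : Measurable f) (_ : ∀ x, |f x| ≤ 1),
    ENNReal.ofReal |∫ x, f x ∂ρ₁ - ∫ x, f x ∂ρ₂|

end Restore

end

namespace Restore

/-! ### Radon spaces -/

/-! Write `c` for the lower bound of the rate. Along almost every path the hazard is `c * t` plus a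
residual hazard with rate `κ - c`, so a cycle ends at the minimum of an Exp(c) time and an
independent residual time. By memorylessness, the first ring of a rate-`c` clock running through all
cycles is an Exp(c) time at which the process restarts from `μ`, whatever happened before. Hence
every `ν P_t` dominates `∫_0^t c e^{-cs} μP_{t-s} ds` (`clockLaw`), which has mass `1 - e^{-ct}` and
does not depend on `ν`. Two probability measures with a common minorant of that mass differ by at
most `2 e^{-ct}` in total variation (`tvNormSub_le_of_le`).

The clock is never built on the sample space. Domination is derived from the renewal equation
`restoreLaw_renewal`, obtained by conditioning on the first cycle. The lifetime law splits as `F = N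
+ F'` according to which of the two times comes first (`eq_thinning`), and the exponential law
satisfies `e = N + F' * e` (`lintegral_expMeasure_decomp`). Since `u(t) = μP_t(B)` dominates `u *
F`, iteration gives `u * e ≤ u` up to an error `F'(ℝ)^n`, which vanishes
(`lintegral_sub_expMeasure_le`); one more application of the decomposition, to the first cycle,
covers an arbitrary `ν` (`lintegral_restoreFn_le`).

The invariant law is the normalised occupation measure of one cycle started from `μ`. Its invariance
follows from the semigroup property of the killed process (`killed_add`) and the renewal identity
`lintegral_survival_mul_eq`. Uniqueness follows by letting `t → ∞` in the total variation bound.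

The killing weight depends on the whole path, so the Markov property must first be extended from one
time to path space. As `x ↦ P_x(A)` is only universally measurable, this is done with almost
everywhere measurable functions throughout. -/

lemma IsRadonSpace.metrizableSpace {E : Type*} [TopologicalSpace E] (h : IsRadonSpace E) :
    TopologicalSpace.MetrizableSpace E := by
  obtain ⟨K, _, _, _, i, hi, -⟩ := h
  let := TopologicalSpace.metrizableSpaceMetric K
  exact hi.metrizableSpace

/-! ### The decreasing exponential on `[0, ∞]` -/

/-- `e^{-a}` for `a ∈ [0, ∞]`. -/
noncomputable def expNeg (a : ℝ≥0∞) : ℝ≥0∞ := EReal.exp (-(a : EReal))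

lemma measurable_expNeg : Measurable expNeg := by
  unfold expNeg; fun_prop

@[simp] lemma expNeg_zero : expNeg 0 = 1 := by simp [expNeg]

@[simp] lemma expNeg_top : expNeg ⊤ = 0 := by simp [expNeg]

lemma expNeg_add (a b : ℝ≥0∞) : expNeg (a + b) = expNeg a * expNeg b := by
  unfold expNeg
  rw [EReal.coe_ennreal_add, EReal.neg_add (by simp) (by simp), sub_eq_add_neg, EReal.exp_add]

lemma expNeg_le_one (a : ℝ≥0∞) : expNeg a ≤ 1 := by
  rw [expNeg, EReal.exp_le_one_iff, EReal.neg_le_zero]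
  exact EReal.coe_ennreal_nonneg a

lemma expNeg_lt_one {a : ℝ≥0∞} (h : 0 < a) : expNeg a < 1 := by
  simpa [expNeg] using h

lemma expNeg_eq_zero {a : ℝ≥0∞} : expNeg a = 0 ↔ a = ⊤ := by
  simp [expNeg]

lemma expNeg_ofReal {r : ℝ} (hr : 0 ≤ r) :
    expNeg (ENNReal.ofReal r) = ENNReal.ofReal (Real.exp (-r)) := by
  have : ((ENNReal.ofReal r : ℝ≥0∞) : EReal) = (r : EReal) := by
    rw [EReal.coe_ennreal_ofReal, max_eq_left hr]
  rw [expNeg, this, ← EReal.coe_neg, EReal.exp_coe]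

lemma expMeasure_Iic {c : ℝ} (hc : 0 < c) (t : ℝ) :
    expMeasure c (Set.Iic t) = ENNReal.ofReal (if 0 ≤ t then 1 - Real.exp (-(c * t)) else 0) := by
  rw [← lintegral_exponentialPDF_eq_antiDeriv hc t]
  rw [expMeasure, gammaMeasure, withDensity_apply _ measurableSet_Iic]
  rfl

lemma expMeasure_Ioi {c : ℝ} (hc : 0 < c) {t : ℝ} (ht : 0 ≤ t) :
    expMeasure c (Set.Ioi t) = ENNReal.ofReal (Real.exp (-(c * t))) := by
  have := isProbabilityMeasure_expMeasure hc
  rw [← Set.compl_Iic, prob_compl_eq_one_sub measurableSet_Iic, expMeasure_Iic hc, if_pos ht,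
    ← ENNReal.ofReal_one, ← ENNReal.ofReal_sub]
  · simp
  · simp; positivity

/-- Integrating out the exponential threshold `ξ` turns the event of survival into the weight
`e^{-hazard}`. The value `a = ⊤` is included because the hazard may be infinite. -/
lemma expMeasure_lt_ofReal (a : ℝ≥0∞) :
    expMeasure 1 {ξ : ℝ | a < ENNReal.ofReal ξ} = expNeg a := by
  induction a with
  | top => simp
  | coe a =>
    have h : {ξ : ℝ | (a : ℝ≥0∞) < ENNReal.ofReal ξ} = Set.Ioi (a : ℝ) := by
      ext ξ
      simp only [Set.mem_ofPred_eq, Set.mem_Ioi]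
      rw [← ENNReal.ofReal_coe_nnreal, ENNReal.ofReal_lt_ofReal_iff_of_nonneg a.coe_nonneg]
    rw [h, expMeasure_Ioi one_pos a.coe_nonneg, ← ENNReal.ofReal_coe_nnreal,
      expNeg_ofReal a.coe_nonneg, one_mul]

instance : IsProbabilityMeasure (expMeasure 1) := isProbabilityMeasure_expMeasure one_pos

lemma ae_expMeasure_pos : ∀ᵐ ξ ∂(expMeasure 1), 0 < ξ := by
  have h : expMeasure 1 (Set.Iic 0) = 0 := by
    rw [expMeasure_Iic one_pos]; simp
  rw [ae_iff]
  simpa [Set.Iic] using h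

/-! ### Right-continuous paths -/

/-- Right-continuity of a path. -/
def RightCts {E : Type*} [TopologicalSpace E] (w : ℝ≥0 → E) : Prop :=
  ∀ t, ContinuousWithinAt w (Set.Ici t) t

section Paths

variable {E : Type*}

lemma RightCts.shift [TopologicalSpace E] {w : ℝ≥0 → E} (hw : RightCts w) (s : ℝ≥0) :
    RightCts (fun t => w (s + t)) := by
  intro t
  refine (hw (s + t)).comp (f := fun t => s + t) (by fun_prop) ?_
  intro r hr
  simpa using hr

lemma RightCts.freeze [TopologicalSpace E] {w : ℝ≥0 → E} (hw : RightCts w) (s : ℝ≥0) :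
    RightCts (fun t => w (min t s)) := by
  intro t
  refine (hw (min t s)).comp (f := fun t => min t s) (by fun_prop) ?_
  intro r hr
  exact min_le_min_right s hr

/-- Discretise time from the right: each approximation takes countably many time values, hence is
jointly measurable, and right-continuity gives pointwise convergence. -/
lemma measurable_uncurry_of_rightCts [TopologicalSpace E] [TopologicalSpace.PseudoMetrizableSpace E]
    [MeasurableSpace E] [BorelSpace E] {Ω' : Type*} [MeasurableSpace Ω']
    {Z : ℝ≥0 → Ω' → E} (hr : ∀ ω, RightCts (fun t => Z t ω)) (hm : ∀ t, Measurable (Z t)) :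
    Measurable (fun p : ℝ≥0 × Ω' => Z p.1 p.2) := by
  -- The `+ 1` in the numerator keeps the grid point to the right of `t`, the side on which the path
  -- is continuous.
  let d : ℕ → ℝ≥0 → ℝ≥0 := fun n t => ((⌊((n : ℝ≥0) + 1) * t⌋₊ : ℝ≥0) + 1) / ((n : ℝ≥0) + 1)
  have hd_le : ∀ n t, t ≤ d n t := by
    intro n t
    rw [le_div_iff₀ (by positivity), mul_comm]
    exact (Nat.lt_floor_add_one _).le
  have hd_up : ∀ n t, d n t ≤ t + 1 / ((n : ℝ≥0) + 1) := by
    intro n t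
    have h : (n : ℝ≥0) + 1 ≠ 0 := by positivity
    rw [div_le_iff₀ (by positivity), add_mul t, one_div, inv_mul_cancel₀ h, mul_comm t]
    gcongr
    exact Nat.floor_le (by positivity)
  have hd_lim : ∀ t, Tendsto (fun n => d n t) atTop (𝓝 t) := by
    intro t
    refine tendsto_of_tendsto_of_tendsto_of_le_of_le tendsto_const_nhds ?_
      (fun n => hd_le n t) (fun n => hd_up n t)
    have := (tendsto_const_nhds (x := t)).add (tendsto_one_div_add_atTop_nhds_zero_nat (𝕜 := ℝ≥0))
    simpa using this
  refine measurable_of_tendsto_metrizable (f := fun n (p : ℝ≥0 × Ω') => Z (d n p.1) p.2) ?_ ?_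
  · intro n
    have : (fun p : ℝ≥0 × Ω' => Z (d n p.1) p.2) =
        (fun q : ℕ × Ω' => Z (((q.1 : ℝ≥0) + 1) / ((n : ℝ≥0) + 1)) q.2) ∘
          (fun p : ℝ≥0 × Ω' => (⌊((n : ℝ≥0) + 1) * p.1⌋₊, p.2)) := rfl
    rw [this]
    refine Measurable.comp (measurable_from_prod_countable_right fun k =>
      hm (((k : ℝ≥0) + 1) / ((n : ℝ≥0) + 1))) ?_
    exact (Nat.measurable_floor.comp (by fun_prop)).prodMk measurable_snd
  · rw [tendsto_pi_nhds]
    intro p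
    exact (hr p.2 p.1).tendsto.comp (tendsto_nhdsWithin_iff.2
      ⟨hd_lim p.1, Eventually.of_forall fun n => hd_le n p.1⟩)

/-- The cumulative hazard `∫_0^t κ(w_s) ds` of a path. -/
noncomputable def cumHazard (κ : E → ℝ≥0) (w : ℝ≥0 → E) (t : ℝ≥0) : ℝ≥0∞ :=
  ∫⁻ s in Set.Icc (0 : ℝ) t, (κ (w s.toNNReal) : ℝ≥0∞)

lemma measurable_cumHazard [MeasurableSpace E]
    {Ω' : Type*} [MeasurableSpace Ω'] {κ : E → ℝ≥0} (hκ : Measurable κ) {Z : ℝ≥0 → Ω' → E}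
    (hZ : Measurable (fun p : ℝ≥0 × Ω' => Z p.1 p.2)) :
    Measurable (fun p : ℝ≥0 × Ω' => cumHazard κ (fun s => Z s p.2) p.1) := by
  have h : ∀ p : ℝ≥0 × Ω', cumHazard κ (fun s => Z s p.2) p.1 =
      ∫⁻ s : ℝ, ({q : (ℝ≥0 × Ω') × ℝ | 0 ≤ q.2 ∧ q.2 ≤ q.1.1}.indicator
        (fun q => (κ (Z q.2.toNNReal q.1.2) : ℝ≥0∞))) (p, s) := by
    intro p
    rw [cumHazard, ← lintegral_indicator measurableSet_Icc]
    rfl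
  simp_rw [h]
  refine Measurable.lintegral_prod_right' (Measurable.indicator ?_ ?_)
  · have : Measurable (fun q : (ℝ≥0 × Ω') × ℝ => Z q.2.toNNReal q.1.2) :=
      hZ.comp ((measurable_real_toNNReal.comp measurable_snd).prodMk
        (measurable_snd.comp measurable_fst))
    exact (hκ.comp this).coe_nnreal_ennreal
  · exact (measurableSet_le measurable_const measurable_snd).inter
      (measurableSet_le measurable_snd
        (measurable_coe_nnreal_real.comp (measurable_fst.comp measurable_fst)))

lemma cumHazard_mono (κ : E → ℝ≥0) (w : ℝ≥0 → E) : Monotone (cumHazard κ w) := by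
  intro s t h
  exact lintegral_mono_set (Set.Icc_subset_Icc le_rfl (by exact_mod_cast h))

@[simp] lemma cumHazard_zero (κ : E → ℝ≥0) (w : ℝ≥0 → E) : cumHazard κ w 0 = 0 := by
  simp [cumHazard]

lemma cumHazard_add (κ : E → ℝ≥0) (w : ℝ≥0 → E) (s t : ℝ≥0) :
    cumHazard κ w (s + t) = cumHazard κ w s + cumHazard κ (fun r => w (s + r)) t := by
  have h1 : Set.Icc (0 : ℝ) ((s + t : ℝ≥0) : ℝ) =
      Set.Icc (0 : ℝ) s ∪ Set.Ioc (s : ℝ) ((s + t : ℝ≥0) : ℝ) := by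
    rw [Set.Icc_union_Ioc_eq_Icc s.coe_nonneg]
    push_cast; linarith [t.coe_nonneg]
  unfold cumHazard
  rw [h1, lintegral_union measurableSet_Ioc]
  · congr 1
    have h2 : Set.Icc (0 : ℝ) t =ᵐ[volume] Set.Ioc (0 : ℝ) t := Ioc_ae_eq_Icc.symm
    rw [setLIntegral_congr h2]
    have h3 : Set.Ioc (0 : ℝ) t = (fun x => (s : ℝ) + x) ⁻¹' Set.Ioc (s : ℝ) ((s + t : ℝ≥0) : ℝ) := by
      ext x; simp
    rw [h3, ← (measurePreserving_add_left volume (s : ℝ)).setLIntegral_comp_preimage_emb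
      (measurableEmbedding_addLeft (s : ℝ))]
    refine setLIntegral_congr_fun (measurableSet_Ioc.preimage (by fun_prop)) ?_
    intro x hx
    have hx' : 0 ≤ x := by
      have := hx.1; simp at this; exact this.le
    simp only
    rw [Real.toNNReal_add s.coe_nonneg hx', Real.toNNReal_coe]
  · rw [Set.disjoint_left]
    intro x hx hx'
    exact absurd hx.2 (not_le.2 hx'.1)

/-- Just after `t` the path stays in a neighbourhood of `w t` on which `κ ≤ C`, so the hazard grows
at rate at most `C` there and cannot jump over the gap to `a`. -/
lemma exists_cumHazard_lt [TopologicalSpace E] {κ : E → ℝ≥0} (hκ : IsLocallyBounded κ) {w : ℝ≥0 → E}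
    (hw : RightCts w) {t : ℝ≥0} {a : ℝ≥0∞} (h : cumHazard κ w t < a) :
    ∃ t' > t, cumHazard κ w t' < a := by
  obtain ⟨U, hU, C, hC⟩ := hκ (w t)
  have h1 : ∀ᶠ r in 𝓝[≥] t, w r ∈ U := hw t hU
  obtain ⟨ε, hε, h2⟩ := Metric.mem_nhdsWithin_iff.1 h1
  obtain ⟨b, hb, hb'⟩ : ∃ b : ℝ≥0, 0 < b ∧ cumHazard κ w t + b ≤ a := by
    obtain ⟨b, hb, hb'⟩ := ENNReal.lt_iff_exists_add_pos_lt.1 h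
    exact ⟨b, hb, hb'.le⟩
  -- The first bound keeps the path in `U`; the second makes the added hazard at most `b / 2`, with
  -- `C + 1` guarding against `C = 0`.
  let δ : ℝ≥0 := min (ε.toNNReal / 2) (b / (2 * (C + 1)))
  have hδ : 0 < δ := by
    refine lt_min ?_ (by positivity)
    have : 0 < ε.toNNReal := by simpa using hε
    positivity
  refine ⟨t + δ, by simpa using hδ, lt_of_lt_of_le ?_ hb'⟩
  rw [cumHazard_add]
  refine ENNReal.add_lt_add_left h.ne_top ?_
  have h3 : cumHazard κ (fun r => w (t + r)) δ ≤ ∫⁻ s in Set.Icc (0 : ℝ) δ, (C : ℝ≥0∞) := by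
    refine setLIntegral_mono measurable_const ?_
    intro x hx
    rw [ENNReal.coe_le_coe]
    refine hC ⟨_, h2 ⟨?_, by simp⟩, rfl⟩
    rw [Metric.mem_ball, NNReal.dist_eq]
    have : (x.toNNReal : ℝ) = x := Real.coe_toNNReal _ hx.1
    push_cast
    rw [this, add_sub_cancel_left, abs_of_nonneg hx.1]
    have h4 : δ ≤ ε.toNNReal / 2 := min_le_left _ _
    have h5 : (δ : ℝ) ≤ ε / 2 := by
      have : (δ : ℝ) ≤ ((ε.toNNReal / 2 : ℝ≥0) : ℝ) := by exact_mod_cast h4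
      simpa [hε.le] using this
    linarith [hx.2, hε]
  refine h3.trans_lt ?_
  rw [setLIntegral_const, Real.volume_Icc, sub_zero, ENNReal.ofReal_coe_nnreal, ← ENNReal.coe_mul,
    ENNReal.coe_lt_coe]
  have h6 : δ ≤ b / (2 * (C + 1)) := min_le_right _ _
  calc C * δ ≤ (C + 1) * (b / (2 * (C + 1))) := by gcongr; simp
    _ = b / 2 := by field_simp
    _ < b := NNReal.half_lt_self hb.ne'

end Paths

/-! ### The lifetime as a hazard event -/

section Lifetime

variable {E Ω : Type*} [TopologicalSpace E] [MeasurableSpace E] [MeasurableSpace Ω]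

/-- If the threshold is reached by time `t`, then `t` competes in the infimum. Conversely, a strict
inequality at `t` persists up to some `t' > t`, so the infimum is at least `t'`; this is where local
boundedness of `κ` enters. -/
lemma lt_lifetime_iff (Y : RightProcess E Ω) {κ : E → ℝ≥0} (hκ : IsLocallyBounded κ)
    (p : Ω × ℝ) (t : ℝ≥0) :
    (t : ℝ≥0∞) < lifetime Y κ p ↔
      cumHazard κ (fun s => Y.path s p.1) t < ENNReal.ofReal p.2 := by
  constructor
  · intro h
    by_contra hn
    exact absurd (iInf₂_le (f := fun (t : ℝ≥0) (_ : ENNReal.ofReal p.2 ≤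
      cumHazard κ (fun s => Y.path s p.1) t) => (t : ℝ≥0∞)) t (not_lt.1 hn)) (not_le.2 h)
  · intro h
    obtain ⟨t', ht', h'⟩ := exists_cumHazard_lt hκ (Y.rightContinuous p.1) h
    refine lt_of_lt_of_le (ENNReal.coe_lt_coe.2 ht') (le_iInf₂ fun s hs => ?_)
    rw [ENNReal.coe_le_coe]
    by_contra hn
    exact absurd (hs.trans (cumHazard_mono κ (fun s => Y.path s p.1) (not_le.1 hn).le))
      (not_le.2 h')

lemma RCMarkovProcess.measurable_path [BorelSpace E] (Y : RCMarkovProcess E Ω) :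
    Measurable (fun p : ℝ≥0 × Ω => Y.path p.1 p.2) := by
  have := Y.radon.metrizableSpace
  exact measurable_uncurry_of_rightCts Y.rightContinuous
    fun t => (Y.adapted t).mono (Y.filtration.le t) le_rfl

lemma measurable_lifetime [BorelSpace E] (Y : RightProcess E Ω) {κ : E → ℝ≥0}
    (hκ : Measurable κ) (hκ' : IsLocallyBounded κ) : Measurable (lifetime Y κ) := by
  refine measurable_of_Ioi fun a => ?_
  induction a with
  | top => simp
  | coe a =>
    have : lifetime Y κ ⁻¹' Set.Ioi (a : ℝ≥0∞) =
        {p | cumHazard κ (fun s => Y.path s p.1) a < ENNReal.ofReal p.2} := by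
      ext p; exact lt_lifetime_iff Y hκ' p a
    rw [this]
    refine measurableSet_lt ?_ (by fun_prop)
    exact (measurable_cumHazard hκ Y.measurable_path).comp
      (measurable_const.prodMk measurable_fst)

end Lifetime

/-! ### The Markov property on path space -/

/-- The space of right-continuous paths, with the σ-algebra generated by the evaluations. -/
abbrev PathSpace (E : Type*) [TopologicalSpace E] := {w : ℝ≥0 → E // RightCts w}

namespace RCMarkovProcess

variable {E Ω : Type*} [TopologicalSpace E] [MeasurableSpace E] [MeasurableSpace Ω]

instance (Y : RCMarkovProcess E Ω) (x : E) : IsProbabilityMeasure (Y.law x) := Y.isProbability x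

lemma measurable_path_apply (Y : RCMarkovProcess E Ω) (t : ℝ≥0) : Measurable (Y.path t) :=
  (Y.adapted t).mono (Y.filtration.le t) le_rfl

lemma measurable_lintegral_law (Y : RCMarkovProcess E Ω) {Φ : Ω → ℝ≥0∞} (hΦ : Measurable Φ) :
    Measurable[universalCompletion E] (fun x => ∫⁻ ω, Φ ω ∂(Y.law x)) := by
  refine Measurable.ennreal_induction (motive := fun Φ => Measurable[universalCompletion E] (fun x => ∫⁻ ω, Φ ω ∂(Y.law x)))
    ?_ ?_ ?_ hΦ
  · intro c s hs
    simp_rw [lintegral_indicator_const hs]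
    exact @Measurable.const_mul _ _ _ _ (universalCompletion E) _ _ (Y.measurable_law s hs) c
  · intro f g _ hf hg ihf ihg
    simp only [Pi.add_apply]
    simp_rw [lintegral_add_left hf]
    exact ihf.add ihg
  · intro f hf hmono ih
    simp_rw [lintegral_iSup hf hmono]
    exact Measurable.iSup ih

lemma aemeasurable_lintegral_law (Y : RCMarkovProcess E Ω) {Φ : Ω → ℝ≥0∞} (hΦ : Measurable Φ)
    (ν : Measure E) [IsFiniteMeasure ν] :
    AEMeasurable (fun x => ∫⁻ ω, Φ ω ∂(Y.law x)) ν :=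
  aemeasurable_of_universal (Y.measurable_lintegral_law hΦ) ν

lemma lintegral_initLaw (Y : RCMarkovProcess E Ω) (ν : Measure E) [IsProbabilityMeasure ν]
    {Φ : Ω → ℝ≥0∞} (hΦ : Measurable Φ) :
    ∫⁻ ω, Φ ω ∂(Y.initLaw ν) = ∫⁻ x, ∫⁻ ω, Φ ω ∂(Y.law x) ∂ν := by
  refine Measurable.ennreal_induction (motive := fun Φ => ∫⁻ ω, Φ ω ∂(Y.initLaw ν) = ∫⁻ x, ∫⁻ ω, Φ ω ∂(Y.law x) ∂ν)
    ?_ ?_ ?_ hΦ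
  · intro c s hs
    simp_rw [lintegral_indicator_const hs]
    rw [initLaw_apply Y ν hs,
      lintegral_const_mul'' _ (aemeasurable_of_universal (Y.measurable_law s hs) ν)]
  · intro f g _ hf hg ihf ihg
    simp only [Pi.add_apply]
    simp_rw [lintegral_add_left hf]
    rw [lintegral_add_left' (Y.aemeasurable_lintegral_law hf ν), ihf, ihg]
  · intro f hf hmono ih
    simp_rw [lintegral_iSup hf hmono]
    rw [lintegral_iSup' (fun n => Y.aemeasurable_lintegral_law (hf n) ν)
      (ae_of_all _ fun x i j hij => lintegral_mono (hmono hij))]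
    exact iSup_congr ih

lemma ae_initLaw (Y : RCMarkovProcess E Ω) (ν : Measure E) [IsProbabilityMeasure ν]
    {s : Set Ω} (hs : MeasurableSet s) (h : ∀ x, ∀ᵐ ω ∂(Y.law x), ω ∈ s) :
    ∀ᵐ ω ∂(Y.initLaw ν), ω ∈ s := by
  change Y.initLaw ν sᶜ = 0
  rw [initLaw_apply Y ν hs.compl]
  have : ∀ x, Y.law x sᶜ = 0 := h
  simp [this]

lemma aemeasurable_comp_path (Y : RCMarkovProcess E Ω) {ψ : E → ℝ≥0∞}
    (hψ : Measurable[universalCompletion E] ψ) (t : ℝ≥0) (P : Measure Ω) [IsFiniteMeasure P] :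
    AEMeasurable (fun ω => ψ (Y.path t ω)) P :=
  (aemeasurable_of_universal hψ (P.map (Y.path t))).comp_measurable (Y.measurable_path_apply t)

lemma markov_lintegral (Y : RCMarkovProcess E Ω) (x : E) (t s : ℝ≥0) {A : Set Ω}
    (hA : MeasurableSet[Y.filtration t] A) {h : E → ℝ≥0∞} (hh : Measurable h) :
    ∫⁻ ω in A, h (Y.path (t + s) ω) ∂(Y.law x) =
      ∫⁻ ω in A, ∫⁻ ω', h (Y.path s ω') ∂(Y.law (Y.path t ω)) ∂(Y.law x) := by
  have hp : ∀ {f : E → ℝ≥0∞}, Measurable f → ∀ r, Measurable fun ω => f (Y.path r ω) :=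
    fun hf r => hf.comp (Y.measurable_path_apply r)
  have haem : ∀ {f : E → ℝ≥0∞}, Measurable f → AEMeasurable
      (fun ω => ∫⁻ ω', f (Y.path s ω') ∂(Y.law (Y.path t ω))) ((Y.law x).restrict A) :=
    fun hf => Y.aemeasurable_comp_path (ψ := fun y => ∫⁻ ω', _ ∂(Y.law y))
      (Y.measurable_lintegral_law (hp hf s)) t _
  refine Measurable.ennreal_induction (motive := fun h => ∫⁻ ω in A, h (Y.path (t + s) ω) ∂(Y.law x) =
      ∫⁻ ω in A, ∫⁻ ω', h (Y.path s ω') ∂(Y.law (Y.path t ω)) ∂(Y.law x))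
    ?_ ?_ ?_ hh
  · intro c B hB
    have e : ∀ r ω, B.indicator (fun _ => c) (Y.path r ω) =
        (Y.path r ⁻¹' B).indicator (fun _ => c) ω := fun _ _ => rfl
    have hB' := fun r => Y.measurable_path_apply r hB
    simp_rw [e, lintegral_indicator_const (hB' _)]
    rw [Measure.restrict_apply (hB' _), Set.inter_comm, Y.markov x t s A B hA hB,
      lintegral_const_mul'' _ (Y.aemeasurable_comp_path (Y.measurable_law _ (hB' s)) t _)]
  · intro f g _ hf hg ihf ihg
    simp only [Pi.add_apply]
    rw [lintegral_add_left (hp hf _), ihf, ihg,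
      ← lintegral_add_left' (haem hf)]
    congr 1
    ext ω
    rw [lintegral_add_left (hp hf _)]
  · intro f hf hmono ih
    have e : ∀ y, ∫⁻ ω', ⨆ n, f n (Y.path s ω') ∂(Y.law y) =
        ⨆ n, ∫⁻ ω', f n (Y.path s ω') ∂(Y.law y) := fun y =>
      lintegral_iSup (fun n => hp (hf n) s)
        (fun i j hij ω => hmono hij _)
    simp_rw [e]
    rw [lintegral_iSup (fun n => hp (hf n) _)
        (fun i j hij ω => hmono hij _),
      lintegral_iSup' (fun n => haem (hf n))
        (ae_of_all _ fun ω i j hij => lintegral_mono fun ω' => hmono hij _)]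
    exact iSup_congr ih

/-- Iterating the Markov property produces integrands `y ↦ P_y(A)` that are only universally
measurable. Such an `h` agrees with a Borel version off a null set `N` of the law of `Y_{t+s}`, and
the Markov property applied to `N` itself shows that `N` is also null for almost every inner law. -/
lemma markov_lintegral_universal (Y : RCMarkovProcess E Ω) (x : E) (t s : ℝ≥0) {A : Set Ω}
    (hA : MeasurableSet[Y.filtration t] A) {h : E → ℝ≥0∞}
    (hh : Measurable[universalCompletion E] h) :
    ∫⁻ ω in A, h (Y.path (t + s) ω) ∂(Y.law x) =
      ∫⁻ ω in A, ∫⁻ ω', h (Y.path s ω') ∂(Y.law (Y.path t ω)) ∂(Y.law x) := by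
  have hm := aemeasurable_of_universal hh ((Y.law x).map (Y.path (t + s)))
  obtain ⟨N, hN, hNm, hN0⟩ := exists_measurable_superset_of_null (ae_iff.1 hm.ae_eq_mk)
  rw [Measure.map_apply (Y.measurable_path_apply _) hNm] at hN0
  have hout : ∀ y, y ∉ N → h y = hm.mk h y := fun y hy => by
    by_contra hc; exact hy (hN hc)
  have h1 : ∀ᵐ ω ∂(Y.law x), Y.path (t + s) ω ∉ N := by
    rw [ae_iff]; simp only [not_not]; exact hN0
  have h2 : ∀ᵐ ω ∂((Y.law x).restrict A), ∀ᵐ ω' ∂(Y.law (Y.path t ω)), Y.path s ω' ∉ N := by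
    have h3 := Y.markov x t s Set.univ N MeasurableSet.univ hNm
    rw [Set.univ_inter, hN0, Measure.restrict_univ] at h3
    have h4 := (lintegral_eq_zero_iff' (Y.aemeasurable_comp_path
      (Y.measurable_law _ (Y.measurable_path_apply s hNm)) t (Y.law x))).1 h3.symm
    refine ae_restrict_of_ae (h4.mono fun ω hω => ?_)
    rw [ae_iff]; simp only [not_not]; exact hω
  rw [lintegral_congr_ae (g := fun ω => hm.mk h (Y.path (t + s) ω)),
    Y.markov_lintegral x t s hA hm.measurable_mk]
  · refine lintegral_congr_ae ?_
    filter_upwards [h2] with ω hω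
    refine lintegral_congr_ae ?_
    filter_upwards [hω] with ω' hω'
    exact (hout _ hω').symm
  · filter_upwards [ae_restrict_of_ae h1] with ω hω
    exact hout _ hω

/-- Induction on the smallest time `a`: the constraint at `a` joins the past event, and the later
constraints become a function `ψ` of `Y_a`. The base time `b` and the event `A` are left free
because both change in the induction. -/
lemma markov_finset (Y : RCMarkovProcess E Ω) {B : ℝ≥0 → Set E} (hB : ∀ i, MeasurableSet (B i))
    (I : Finset ℝ≥0) : ∀ b : ℝ≥0, (∀ i ∈ I, b ≤ i) → ∀ (x : E) (t : ℝ≥0) (A : Set Ω),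
      MeasurableSet[Y.filtration t] A →
      Y.law x (A ∩ {ω | ∀ i ∈ I, Y.path (t + (i - b)) ω ∈ B i}) =
        ∫⁻ ω in A, Y.law (Y.path t ω) {ω' | ∀ i ∈ I, Y.path (i - b) ω' ∈ B i} ∂(Y.law x) := by
  have hcyl : ∀ (J : Finset ℝ≥0) (g : ℝ≥0 → ℝ≥0),
      MeasurableSet {ω | ∀ i ∈ J, Y.path (g i) ω ∈ B i} := by
    intro J g
    have : {ω | ∀ i ∈ J, Y.path (g i) ω ∈ B i} = ⋂ i ∈ J, Y.path (g i) ⁻¹' B i := by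
      ext; simp
    rw [this]
    exact Finset.measurableSet_biInter _ fun i _ => Y.measurable_path_apply _ (hB i)
  induction I using Finset.induction_on_min with
  | empty => intro b _ x t A hA; simp
  | insert a I hlt ih =>
    intro b hb x t A hA
    have hba : b ≤ a := hb a (Finset.mem_insert_self a I)
    have haI : ∀ i ∈ I, a ≤ i := fun i hi => (hlt i hi).le
    let ψ : E → ℝ≥0∞ := fun y => Y.law y {ω' | ∀ i ∈ I, Y.path (i - a) ω' ∈ B i}
    have hψ : Measurable[universalCompletion E] ψ := Y.measurable_law _ (hcyl I _)
    have hψ' : Measurable[universalCompletion E] ((B a).indicator ψ) := by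
      refine hψ.indicator ?_
      exact fun ν _ => (hB a).nullMeasurableSet
    -- Used twice: from `x` with the event `A` at time `t`, and from the restarted point `Y_t` with
    -- the trivial event at time `0`. The one-time Markov property links the two.
    have key : ∀ (y : E) (r : ℝ≥0) (D : Set Ω), MeasurableSet[Y.filtration r] D →
        Y.law y (D ∩ {ω | ∀ i ∈ insert a I, Y.path (r + (i - b)) ω ∈ B i}) =
          ∫⁻ ω in D, (B a).indicator ψ (Y.path (r + (a - b)) ω) ∂(Y.law y) := by
      intro y r D hD
      have hle : r ≤ r + (a - b) := le_self_add
      have hBa : MeasurableSet[Y.filtration (r + (a - b))] (Y.path (r + (a - b)) ⁻¹' B a) :=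
        Y.adapted _ (hB a)
      have hD' : MeasurableSet[Y.filtration (r + (a - b))] (D ∩ Y.path (r + (a - b)) ⁻¹' B a) :=
        MeasurableSet.inter (Y.filtration.mono hle D hD) hBa
      have e1 : D ∩ {ω | ∀ i ∈ insert a I, Y.path (r + (i - b)) ω ∈ B i} =
          (D ∩ Y.path (r + (a - b)) ⁻¹' B a) ∩
            {ω | ∀ i ∈ I, Y.path ((r + (a - b)) + (i - a)) ω ∈ B i} := by
        ext ω
        have h5 : ∀ i ∈ I, r + (a - b) + (i - a) = r + (i - b) := by
          intro i hi
          rw [add_assoc, add_comm (a - b), tsub_add_tsub_cancel (haI i hi) hba]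
        have h6 : (∀ i ∈ I, Y.path (r + (a - b) + (i - a)) ω ∈ B i) ↔
            ∀ i ∈ I, Y.path (r + (i - b)) ω ∈ B i :=
          forall₂_congr fun i hi => by rw [h5 i hi]
        simp only [Set.mem_inter_iff, Set.mem_ofPred_eq, Finset.forall_mem_insert, h6,
          Set.mem_preimage, and_assoc]
      rw [e1, ih a haI y _ _ hD', Set.inter_comm, ← Measure.restrict_restrict
        (Y.filtration.le _ _ hBa), ← lintegral_indicator (Y.filtration.le _ _ hBa)]
      rfl
    rw [key x t A hA, Y.markov_lintegral_universal x t (a - b) hA hψ']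
    refine lintegral_congr fun ω => ?_
    have := key (Y.path t ω) 0 Set.univ MeasurableSet.univ
    simp only [zero_add, Set.univ_inter, Measure.restrict_univ] at this
    exact this.symm

/-- The path of the process after time `t`. -/
def pathFrom (Y : RCMarkovProcess E Ω) (t : ℝ≥0) (ω : Ω) : PathSpace E :=
  ⟨fun s => Y.path (t + s) ω, RightCts.shift (Y.rightContinuous ω) t⟩

lemma measurable_pathFrom (Y : RCMarkovProcess E Ω) (t : ℝ≥0) : Measurable (Y.pathFrom t) :=
  Measurable.subtype_mk (measurable_pi_lambda _ fun s => Y.measurable_path_apply (t + s))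

/-- Finite-dimensional cylinders form a π-system generating the path σ-algebra, so the Markov
property spreads from `markov_finset` by Dynkin's argument. -/
lemma markov_path (Y : RCMarkovProcess E Ω) (x : E) (t : ℝ≥0) {A : Set Ω}
    (hA : MeasurableSet[Y.filtration t] A) {C : Set (PathSpace E)} (hC : MeasurableSet C) :
    Y.law x (A ∩ Y.pathFrom t ⁻¹' C) =
      ∫⁻ ω in A, Y.law (Y.path t ω) (Y.pathFrom 0 ⁻¹' C) ∂(Y.law x) := by
  have hA' := Y.filtration.le t A hA
  have hgen : (inferInstance : MeasurableSpace (PathSpace E)) = MeasurableSpace.generateFrom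
      ((fun s => Subtype.val ⁻¹' s) ''
        (squareCylinders fun _ : ℝ≥0 => {s : Set E | MeasurableSet s})) := by
    rw [← MeasurableSpace.comap_generateFrom, generateFrom_squareCylinders]
    rfl
  have hpi : IsPiSystem ((fun s : Set (ℝ≥0 → E) => (Subtype.val ⁻¹' s : Set (PathSpace E))) ''
      (squareCylinders fun _ : ℝ≥0 => {s : Set E | MeasurableSet s})) :=
    IsPiSystem.comap (isPiSystem_squareCylinders (fun _ => MeasurableSpace.isPiSystem_measurableSet)
      (by simp)) _
  have hm := fun {C : Set (PathSpace E)} (hC : MeasurableSet C) => Y.measurable_pathFrom t hC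
  have haem : ∀ {C : Set (PathSpace E)}, MeasurableSet C → AEMeasurable
      (fun ω => Y.law (Y.path t ω) (Y.pathFrom 0 ⁻¹' C)) ((Y.law x).restrict A) := fun hC =>
    Y.aemeasurable_comp_path (Y.measurable_law _ (Y.measurable_pathFrom 0 hC)) t _
  induction C, hC using MeasurableSpace.induction_on_inter hgen hpi with
  | empty => simp
  | basic C hC =>
    obtain ⟨_, ⟨I, B, hB, rfl⟩, rfl⟩ := hC
    have hB' : ∀ i, MeasurableSet (B i) := fun i => hB i (Set.mem_univ i)
    have := Y.markov_finset hB' I 0 (fun _ _ => zero_le) x t A hA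
    simp only [tsub_zero] at this
    have e : ∀ r, Y.pathFrom r ⁻¹' (Subtype.val ⁻¹' ((I : Set ℝ≥0).pi B)) =
        {ω | ∀ i ∈ I, Y.path (r + i) ω ∈ B i} := fun r => rfl
    simp only [e, zero_add]
    exact this
  | compl C hC ih =>
    have h1 := measure_inter_add_sdiff (μ := Y.law x) A (hm hC)
    have h2 : Y.law x A = ∫⁻ ω in A, Y.law (Y.path t ω) (Y.pathFrom 0 ⁻¹' C) ∂(Y.law x) +
        ∫⁻ ω in A, Y.law (Y.path t ω) (Y.pathFrom 0 ⁻¹' Cᶜ) ∂(Y.law x) := by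
      rw [← lintegral_add_left' (haem hC)]
      simp_rw [Set.preimage_compl, prob_add_prob_compl (Y.measurable_pathFrom 0 hC)]
      simp
    rw [h2, ih, Set.sdiff_eq] at h1
    refine (ENNReal.add_right_inj ?_).1 h1
    rw [← ih]
    exact measure_ne_top _ _
  | iUnion f hd hf ih =>
    simp_rw [Set.preimage_iUnion, Set.inter_iUnion]
    rw [measure_iUnion (fun i j hij => ((hd hij).preimage _).mono Set.inter_subset_right
      Set.inter_subset_right) (fun i => hA'.inter (hm (hf i)))]
    have e : ∀ ω, Y.law (Y.path t ω) (⋃ i, Y.pathFrom 0 ⁻¹' f i) =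
        ∑' i, Y.law (Y.path t ω) (Y.pathFrom 0 ⁻¹' f i) := fun ω =>
      measure_iUnion (fun i j hij => (hd hij).preimage _) fun i => Y.measurable_pathFrom 0 (hf i)
    simp_rw [e]
    rw [lintegral_tsum fun i => haem (hf i)]
    exact tsum_congr ih

end RCMarkovProcess

/-- The measures with densities `f` and `g` have the same trace on `m`, and an `m`-measurable `G`
only sees that trace. -/
lemma lintegral_mul_eq_of_setLIntegral_eq {Ω : Type*} {m m0 : MeasurableSpace Ω} (hm : m ≤ m0)
    (P : Measure Ω) {f g : Ω → ℝ≥0∞} (hf : AEMeasurable f P) (hg : AEMeasurable g P)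
    (h : ∀ A, MeasurableSet[m] A → ∫⁻ ω in A, f ω ∂P = ∫⁻ ω in A, g ω ∂P)
    {G : Ω → ℝ≥0∞} (hG : Measurable[m] G) :
    ∫⁻ ω, f ω * G ω ∂P = ∫⁻ ω, g ω * G ω ∂P := by
  have e : (P.withDensity f).trim hm = (P.withDensity g).trim hm := by
    refine @Measure.ext _ m _ _ fun A hA => ?_
    rw [trim_measurableSet_eq hm hA, trim_measurableSet_eq hm hA,
      withDensity_apply _ (hm A hA), withDensity_apply _ (hm A hA), h A hA]
  have hG' : Measurable G := hG.mono hm le_rfl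
  have h1 := lintegral_withDensity_eq_lintegral_mul₀ hf hG'.aemeasurable
  have h2 := lintegral_withDensity_eq_lintegral_mul₀ hg hG'.aemeasurable
  simp only [Pi.mul_apply] at h1 h2
  rw [← h1, ← h2, ← lintegral_trim hm hG, ← lintegral_trim hm hG, e]

namespace RCMarkovProcess

variable {E Ω : Type*} [TopologicalSpace E] [MeasurableSpace E] [MeasurableSpace Ω]

lemma setLIntegral_pathFrom (Y : RCMarkovProcess E Ω) (x : E) (t : ℝ≥0) {A : Set Ω}
    (hA : MeasurableSet[Y.filtration t] A) {Φ : PathSpace E → ℝ≥0∞} (hΦ : Measurable Φ) :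
    ∫⁻ ω in A, Φ (Y.pathFrom t ω) ∂(Y.law x) =
      ∫⁻ ω in A, ∫⁻ ω', Φ (Y.pathFrom 0 ω') ∂(Y.law (Y.path t ω)) ∂(Y.law x) := by
  have hp : ∀ {f : PathSpace E → ℝ≥0∞}, Measurable f →
      ∀ r, Measurable fun ω => f (Y.pathFrom r ω) := fun hf r => hf.comp (Y.measurable_pathFrom r)
  have haem : ∀ {f : PathSpace E → ℝ≥0∞}, Measurable f → AEMeasurable
      (fun ω => ∫⁻ ω', f (Y.pathFrom 0 ω') ∂(Y.law (Y.path t ω))) ((Y.law x).restrict A) :=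
    fun hf => Y.aemeasurable_comp_path (ψ := fun y => ∫⁻ ω', _ ∂(Y.law y))
      (Y.measurable_lintegral_law (hp hf 0)) t _
  refine Measurable.ennreal_induction
    (motive := fun Φ => ∫⁻ ω in A, Φ (Y.pathFrom t ω) ∂(Y.law x) =
      ∫⁻ ω in A, ∫⁻ ω', Φ (Y.pathFrom 0 ω') ∂(Y.law (Y.path t ω)) ∂(Y.law x)) ?_ ?_ ?_ hΦ
  · intro c B hB
    have e : ∀ r ω, B.indicator (fun _ => c) (Y.pathFrom r ω) =
        (Y.pathFrom r ⁻¹' B).indicator (fun _ => c) ω := fun _ _ => rfl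
    have hB' := fun r => Y.measurable_pathFrom r hB
    simp_rw [e, lintegral_indicator_const (hB' _)]
    rw [Measure.restrict_apply (hB' _), Set.inter_comm, Y.markov_path x t hA hB,
      lintegral_const_mul'' _ (Y.aemeasurable_comp_path (Y.measurable_law _ (hB' 0)) t _)]
  · intro f g _ hf hg ihf ihg
    simp only [Pi.add_apply]
    rw [lintegral_add_left (hp hf _), ihf, ihg, ← lintegral_add_left' (haem hf)]
    congr 1
    ext ω
    rw [lintegral_add_left (hp hf _)]
  · intro f hf hmono ih
    have e : ∀ y, ∫⁻ ω', ⨆ n, f n (Y.pathFrom 0 ω') ∂(Y.law y) =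
        ⨆ n, ∫⁻ ω', f n (Y.pathFrom 0 ω') ∂(Y.law y) := fun y =>
      lintegral_iSup (fun n => hp (hf n) 0) (fun i j hij ω => hmono hij _)
    simp_rw [e]
    rw [lintegral_iSup (fun n => hp (hf n) _) (fun i j hij ω => hmono hij _),
      lintegral_iSup' (fun n => haem (hf n))
        (ae_of_all _ fun ω i j hij => lintegral_mono fun ω' => hmono hij _)]
    exact iSup_congr ih

lemma lintegral_pathFrom_mul (Y : RCMarkovProcess E Ω) (x : E) (t : ℝ≥0) {G : Ω → ℝ≥0∞}
    (hG : Measurable[Y.filtration t] G) {Φ : PathSpace E → ℝ≥0∞} (hΦ : Measurable Φ) :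
    ∫⁻ ω, Φ (Y.pathFrom t ω) * G ω ∂(Y.law x) =
      ∫⁻ ω, (∫⁻ ω', Φ (Y.pathFrom 0 ω') ∂(Y.law (Y.path t ω))) * G ω ∂(Y.law x) :=
  lintegral_mul_eq_of_setLIntegral_eq (Y.filtration.le t) (Y.law x)
    (hΦ.comp (Y.measurable_pathFrom t)).aemeasurable
    (Y.aemeasurable_comp_path (ψ := fun y => ∫⁻ _, _ ∂(Y.law y))
      (Y.measurable_lintegral_law (hΦ.comp (Y.measurable_pathFrom 0))) t _)
    (fun _ hA => Y.setLIntegral_pathFrom x t hA hΦ) hG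

/-- A `P_ν`-null set is `P_x`-null for `ν`-almost every `x`, so a Borel version may be substituted
on both sides. -/
lemma lintegral_initLaw_of_aemeasurable (Y : RCMarkovProcess E Ω) (ν : Measure E)
    [IsProbabilityMeasure ν] {Φ : Ω → ℝ≥0∞} (hΦ : AEMeasurable Φ (Y.initLaw ν)) :
    ∫⁻ ω, Φ ω ∂(Y.initLaw ν) = ∫⁻ x, ∫⁻ ω, Φ ω ∂(Y.law x) ∂ν := by
  obtain ⟨N, hN, hNm, hN0⟩ := exists_measurable_superset_of_null (ae_iff.1 hΦ.ae_eq_mk)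
  rw [lintegral_congr_ae hΦ.ae_eq_mk, Y.lintegral_initLaw ν hΦ.measurable_mk]
  rw [initLaw_apply Y ν hNm,
    lintegral_eq_zero_iff' (aemeasurable_of_universal (Y.measurable_law _ hNm) ν)] at hN0
  refine lintegral_congr_ae ?_
  filter_upwards [hN0] with x hx
  refine lintegral_congr_ae ?_
  have h : ∀ᵐ ω ∂(Y.law x), ω ∉ N := by
    rw [ae_iff]; simp only [not_not]; exact hx
  filter_upwards [h] with ω hω
  by_contra hc
  exact hω (hN fun h => hc h.symm)

/-! ### The killed semigroup -/

/-- The weight `e^{-∫_0^t κ(Y_s) ds}`. -/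
noncomputable def survival (Y : RCMarkovProcess E Ω) (κ : E → ℝ≥0) (t : ℝ≥0) (ω : Ω) : ℝ≥0∞ :=
  expNeg (cumHazard κ (fun s => Y.path s ω) t)

lemma survival_le_one (Y : RCMarkovProcess E Ω) (κ : E → ℝ≥0) (t : ℝ≥0) (ω : Ω) :
    Y.survival κ t ω ≤ 1 := expNeg_le_one _

/-- `E_x[e^{-∫_0^t κ(Y_s) ds}; Y_t ∈ B]`. -/
noncomputable def killed (Y : RCMarkovProcess E Ω) (κ : E → ℝ≥0) (t : ℝ≥0) (B : Set E)
    (P : Measure Ω) : ℝ≥0∞ :=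
  ∫⁻ ω, B.indicator 1 (Y.path t ω) * Y.survival κ t ω ∂P

lemma killed_le_one (Y : RCMarkovProcess E Ω) (κ : E → ℝ≥0) (t : ℝ≥0) (B : Set E)
    (P : Measure Ω) [IsProbabilityMeasure P] : Y.killed κ t B P ≤ 1 := by
  calc Y.killed κ t B P ≤ ∫⁻ _, 1 ∂P := lintegral_mono fun ω =>
        mul_le_one' (Set.indicator_apply_le fun _ => le_rfl) (Y.survival_le_one κ t ω)
    _ = 1 := by simp

variable [BorelSpace E]

lemma measurable_survival (Y : RCMarkovProcess E Ω) {κ : E → ℝ≥0} (hκ : Measurable κ) :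
    Measurable (fun p : ℝ≥0 × Ω => Y.survival κ p.1 p.2) :=
  measurable_expNeg.comp (measurable_cumHazard hκ Y.measurable_path)

lemma measurable_survival_apply (Y : RCMarkovProcess E Ω) {κ : E → ℝ≥0} (hκ : Measurable κ)
    (t : ℝ≥0) : Measurable (Y.survival κ t) :=
  (Y.measurable_survival hκ).comp measurable_prodMk_left

/-- Freezing the path at time `t` leaves the hazard up to `t` unchanged and makes every coordinate
measurable for the σ-algebra at time `t`; joint measurability is then applied with that σ-algebra.
-/
lemma measurable_filtration_survival (Y : RCMarkovProcess E Ω) {κ : E → ℝ≥0} (hκ : Measurable κ)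
    (t : ℝ≥0) : Measurable[Y.filtration t] (Y.survival κ t) := by
  have := Y.radon.metrizableSpace
  have h := @measurable_uncurry_of_rightCts E _ _ _ _ Ω (Y.filtration t)
    (fun s ω => Y.path (min s t) ω) (fun ω => RightCts.freeze (Y.rightContinuous ω) t)
    (fun s => (Y.adapted (min s t)).mono (Y.filtration.mono (min_le_right s t)) le_rfl)
  have h' := @measurable_cumHazard E _ Ω (Y.filtration t) κ hκ (fun s ω => Y.path (min s t) ω) h
  have h'' := h'.comp (@measurable_prodMk_left _ _ _ (Y.filtration t) t)
  refine measurable_expNeg.comp ?_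
  convert h'' using 1
  ext ω
  refine setLIntegral_congr_fun measurableSet_Icc fun s hs => ?_
  have : min s.toNNReal t = s.toNNReal := min_eq_left (Real.toNNReal_le_iff_le_coe.2 hs.2)
  simp [this]

lemma measurable_killed_integrand (Y : RCMarkovProcess E Ω) {κ : E → ℝ≥0} (hκ : Measurable κ)
    {B : Set E} (hB : MeasurableSet B) :
    Measurable (fun p : ℝ≥0 × Ω => B.indicator (1 : E → ℝ≥0∞) (Y.path p.1 p.2) *
      Y.survival κ p.1 p.2) :=
  ((measurable_one.indicator hB).comp Y.measurable_path).mul (Y.measurable_survival hκ)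

lemma measurable_killed_integrand_apply (Y : RCMarkovProcess E Ω) {κ : E → ℝ≥0}
    (hκ : Measurable κ) {B : Set E} (hB : MeasurableSet B) (t : ℝ≥0) :
    Measurable (fun ω => B.indicator (1 : E → ℝ≥0∞) (Y.path t ω) * Y.survival κ t ω) :=
  (Y.measurable_killed_integrand hκ hB).comp measurable_prodMk_left

lemma measurable_killed (Y : RCMarkovProcess E Ω) {κ : E → ℝ≥0} (hκ : Measurable κ)
    {B : Set E} (hB : MeasurableSet B) (P : Measure Ω) [SFinite P] :
    Measurable (fun t => Y.killed κ t B P) :=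
  (Y.measurable_killed_integrand hκ hB).lintegral_prod_right'

lemma measurable_killed_law (Y : RCMarkovProcess E Ω) {κ : E → ℝ≥0} (hκ : Measurable κ)
    {B : Set E} (hB : MeasurableSet B) (t : ℝ≥0) :
    Measurable[universalCompletion E] (fun x => Y.killed κ t B (Y.law x)) :=
  Y.measurable_lintegral_law (Y.measurable_killed_integrand_apply hκ hB t)

lemma killed_initLaw (Y : RCMarkovProcess E Ω) {κ : E → ℝ≥0} (hκ : Measurable κ)
    {B : Set E} (hB : MeasurableSet B) (t : ℝ≥0) (ν : Measure E) [IsProbabilityMeasure ν] :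
    Y.killed κ t B (Y.initLaw ν) = ∫⁻ x, Y.killed κ t B (Y.law x) ∂ν :=
  Y.lintegral_initLaw ν (Y.measurable_killed_integrand_apply hκ hB t)

/-- The semigroup property of the killed process, started from an initial distribution. -/
lemma killed_add (Y : RCMarkovProcess E Ω) {κ : E → ℝ≥0} (hκ : Measurable κ)
    {B : Set E} (hB : MeasurableSet B) (s t : ℝ≥0) (ν : Measure E) [IsProbabilityMeasure ν] :
    Y.killed κ (s + t) B (Y.initLaw ν) =
      ∫⁻ ω, Y.killed κ t B (Y.law (Y.path s ω)) * Y.survival κ s ω ∂(Y.initLaw ν) := by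
  have := Y.radon.metrizableSpace
  let Φ : PathSpace E → ℝ≥0∞ := fun w => B.indicator 1 (w.1 t) * expNeg (cumHazard κ w.1 t)
  have hΦ : Measurable Φ := by
    have h1 : Measurable (fun p : ℝ≥0 × PathSpace E => p.2.1 p.1) :=
      measurable_uncurry_of_rightCts (Z := fun s (w : PathSpace E) => w.1 s)
        (fun w => w.2) (fun s => (measurable_pi_apply s).comp measurable_subtype_coe)
    have h2 := measurable_cumHazard hκ (Z := fun s (w : PathSpace E) => w.1 s) h1
    exact (((measurable_one.indicator hB).comp h1).comp measurable_prodMk_left).mul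
      (measurable_expNeg.comp (h2.comp measurable_prodMk_left))
  have hx : ∀ x, Y.killed κ (s + t) B (Y.law x) =
      ∫⁻ ω, Y.killed κ t B (Y.law (Y.path s ω)) * Y.survival κ s ω ∂(Y.law x) := by
    intro x
    have h := Y.lintegral_pathFrom_mul x s (Y.measurable_filtration_survival hκ s) hΦ
    -- The hazard is additive in time, so the weight factors into a part known at time `s` and a
    -- functional of the shifted path.
    have e1 : ∀ ω, Φ (Y.pathFrom s ω) * Y.survival κ s ω =
        B.indicator 1 (Y.path (s + t) ω) * Y.survival κ (s + t) ω := by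
      intro ω
      simp only [survival, cumHazard_add, expNeg_add, Φ, pathFrom]
      ring
    have e2 : ∀ ω, Φ (Y.pathFrom 0 ω) = B.indicator 1 (Y.path t ω) * Y.survival κ t ω := by
      intro ω
      simp only [survival, Φ, pathFrom, zero_add]
    simp_rw [e1, e2] at h
    exact h
  rw [Y.killed_initLaw hκ hB]
  simp_rw [hx]
  have haem : AEMeasurable (fun ω => Y.killed κ t B (Y.law (Y.path s ω)) * Y.survival κ s ω)
      (Y.initLaw ν) := by
    exact (Y.aemeasurable_comp_path (Y.measurable_killed_law hκ hB t) s _).mul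
      (Y.measurable_survival_apply hκ s).aemeasurable
  exact (Y.lintegral_initLaw_of_aemeasurable ν haem).symm

end RCMarkovProcess

/-! ### Sequences of independent cycles -/

section Sequences

variable {X : Type*} [MeasurableSpace X]

/-- Splitting off the first term of a sequence. -/
def splitSeq (z : ℕ → X) : X × (ℕ → X) := (z 0, fun n => z (n + 1))

lemma measurable_splitSeq : Measurable (splitSeq : (ℕ → X) → X × (ℕ → X)) := by
  unfold splitSeq; fun_prop

/-- Prepending a term to a sequence. -/
def joinSeq (p : X × (ℕ → X)) : ℕ → X
  | 0 => p.1
  | n + 1 => p.2 n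

lemma measurable_joinSeq : Measurable (joinSeq : X × (ℕ → X) → ℕ → X) := by
  refine measurable_pi_lambda _ fun n => ?_
  cases n with
  | zero => exact measurable_fst
  | succ n => exact (measurable_pi_apply n).comp measurable_snd

/-- Both laws are compared on finite boxes. Padding a box with full factors to the index set `range
(N + 1)`, which always contains `0`, separates the head from the tail. -/
lemma map_joinSeq (ρ : Measure X) [IsProbabilityMeasure ρ] :
    (ρ.prod (Measure.infinitePi fun _ : ℕ => ρ)).map joinSeq = Measure.infinitePi fun _ => ρ := by
  classical
  refine Measure.eq_infinitePi _ fun s t ht => ?_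
  let t' : ℕ → Set X := fun i => if i ∈ s then t i else Set.univ
  have ht' : ∀ i, MeasurableSet (t' i) := by
    intro i
    by_cases hi : i ∈ s
    · simpa [t', hi] using ht i
    · simp [t', hi]
  obtain ⟨N, hN⟩ := s.exists_nat_subset_range
  have hsub : s ⊆ Finset.range (N + 1) := hN.trans (Finset.range_subset_range.2 N.le_succ)
  have e1 : (s : Set ℕ).pi t = ((Finset.range (N + 1) : Finset ℕ) : Set ℕ).pi t' := by
    ext z
    simp only [Set.mem_pi, Finset.mem_coe, t']
    constructor
    · intro h i _
      by_cases hi : i ∈ s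
      · simpa [hi] using h i hi
      · simp [hi]
    · intro h i hi
      simpa [hi] using h i (hsub hi)
  have e2 : ∏ i ∈ s, ρ (t i) = ∏ i ∈ Finset.range (N + 1), ρ (t' i) := by
    rw [← Finset.prod_subset hsub (f := fun i => ρ (t' i))]
    · exact Finset.prod_congr rfl fun i hi => by simp [t', hi]
    · intro i _ hi
      simp [t', hi]
  have e3 : joinSeq ⁻¹' ((Finset.range (N + 1) : Finset ℕ) : Set ℕ).pi t' =
      t' 0 ×ˢ ((Finset.range N : Finset ℕ) : Set ℕ).pi fun i => t' (i + 1) := by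
    ext p
    simp only [Set.mem_preimage, Set.mem_pi, Finset.coe_range, Set.mem_Iio, Set.mem_prod]
    constructor
    · exact fun h => ⟨h 0 (by omega), fun i hi => h (i + 1) (by omega)⟩
    · rintro ⟨h0, h⟩ i hi
      cases i with
      | zero => exact h0
      | succ i => exact h i (by omega)
  rw [e1, e2, Measure.map_apply measurable_joinSeq
    (MeasurableSet.pi (Finset.countable_toSet _) fun i _ => ht' i), e3, Measure.prod_prod,
    Measure.infinitePi_pi _ (fun i _ => ht' (i + 1)), Finset.prod_range_succ', mul_comm]

lemma map_splitSeq (ρ : Measure X) [IsProbabilityMeasure ρ] :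
    (Measure.infinitePi fun _ : ℕ => ρ).map splitSeq =
      ρ.prod (Measure.infinitePi fun _ : ℕ => ρ) := by
  rw [← map_joinSeq ρ, Measure.map_map measurable_splitSeq measurable_joinSeq, map_joinSeq ρ]
  exact Measure.map_id

end Sequences

/-! ### Regeneration times and the first-cycle decomposition of the path -/

section Construction

variable {E Ω : Type*} [TopologicalSpace E] [MeasurableSpace E] [MeasurableSpace Ω]

/-- The law of a cycle `(Y, ξ)` started from `ν`. -/
noncomputable def cycleLaw (Y : RightProcess E Ω) (ν : Measure E) [IsProbabilityMeasure ν] :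
    Measure (Ω × ℝ) := (Y.initLaw ν).prod (expMeasure 1)

instance (Y : RightProcess E Ω) (ν : Measure E) [IsProbabilityMeasure ν] :
    IsProbabilityMeasure (cycleLaw Y ν) := by unfold cycleLaw; infer_instance

lemma restoreMeasure_eq (Y : RightProcess E Ω) (μ ν : Measure E)
    [IsProbabilityMeasure μ] [IsProbabilityMeasure ν] :
    restoreMeasure Y μ ν = (cycleLaw Y ν).prod (Measure.infinitePi fun _ => cycleLaw Y μ) := rfl

instance (Y : RightProcess E Ω) (μ ν : Measure E)
    [IsProbabilityMeasure μ] [IsProbabilityMeasure ν] :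
    IsProbabilityMeasure (restoreMeasure Y μ ν) := by rw [restoreMeasure_eq]; infer_instance

lemma lintegral_splitSeq (Y : RightProcess E Ω) (μ : Measure E) [IsProbabilityMeasure μ]
    {f : CycleSpace Ω → ℝ≥0∞} (hf : Measurable f) :
    ∫⁻ z, f (splitSeq z) ∂(Measure.infinitePi fun _ : ℕ => cycleLaw Y μ) =
      ∫⁻ w, f w ∂(restoreMeasure Y μ μ) := by
  rw [restoreMeasure_eq, ← map_splitSeq, lintegral_map hf measurable_splitSeq]

lemma cycle_splitSeq {Ω : Type*} (w : CycleSpace Ω) (i : ℕ) : cycle (splitSeq w.2) i = cycle w (i + 1) := by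
  cases i <;> rfl

lemma measurable_cycle (i : ℕ) : Measurable (fun w : CycleSpace Ω => cycle w i) := by
  cases i with
  | zero => exact measurable_fst
  | succ i => exact (measurable_pi_apply i).comp measurable_snd

lemma regenTime_zero (Y : RightProcess E Ω) (κ : E → ℝ≥0) (w : CycleSpace Ω) :
    regenTime Y κ 0 w = 0 := by simp [regenTime]

lemma regenTime_one (Y : RightProcess E Ω) (κ : E → ℝ≥0) (w : CycleSpace Ω) :
    regenTime Y κ 1 w = lifetime Y κ w.1 := by simp [regenTime, cycle]

lemma regenTime_succ (Y : RightProcess E Ω) (κ : E → ℝ≥0) (w : CycleSpace Ω) (n : ℕ) :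
    regenTime Y κ (n + 1) w = lifetime Y κ w.1 + regenTime Y κ n (splitSeq w.2) := by
  simp only [regenTime, Finset.sum_range_succ', cycle_splitSeq]
  rw [add_comm]
  rfl

lemma regenTime_mono (Y : RightProcess E Ω) (κ : E → ℝ≥0) (w : CycleSpace Ω) :
    Monotone fun n => regenTime Y κ n w := by
  intro m n h
  exact Finset.sum_le_sum_of_subset (Finset.range_subset_range.2 h)

lemma exists_regenTime (Y : RightProcess E Ω) (κ : E → ℝ≥0) {w : CycleSpace Ω}
    (h : ∑' i, lifetime Y κ (cycle w i) = ⊤) (t : ℝ≥0) :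
    ∃ i, regenTime Y κ i w ≤ t ∧ (t : ℝ≥0∞) < regenTime Y κ (i + 1) w := by
  classical
  have hex : ∃ n, (t : ℝ≥0∞) < regenTime Y κ n w := by
    have h1 : (t : ℝ≥0∞) < ⨆ n, regenTime Y κ n w := by
      rw [ENNReal.tsum_eq_iSup_nat] at h
      exact h ▸ ENNReal.coe_lt_top
    exact lt_iSup_iff.1 h1
  have h0 : Nat.find hex ≠ 0 := by
    intro h0
    have := Nat.find_spec hex
    rw [h0, regenTime_zero] at this
    exact not_lt_zero this
  obtain ⟨i, hi⟩ := Nat.exists_eq_succ_of_ne_zero h0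
  refine ⟨i, not_lt.1 (Nat.find_min hex (by omega)), ?_⟩
  have := Nat.find_spec hex
  rwa [hi] at this

lemma restorePath_eq (Y : RightProcess E Ω) (κ : E → ℝ≥0) {t : ℝ≥0} {w : CycleSpace Ω} {i : ℕ}
    (h : regenTime Y κ i w ≤ t ∧ (t : ℝ≥0∞) < regenTime Y κ (i + 1) w) :
    restorePath Y κ t w = Y.path (t - (regenTime Y κ i w).toNNReal) (cycle w i).1 := by
  classical
  have hex : ∃ i, regenTime Y κ i w ≤ t ∧ (t : ℝ≥0∞) < regenTime Y κ (i + 1) w := ⟨i, h⟩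
  have huniq : ∀ j, (regenTime Y κ j w ≤ t ∧ (t : ℝ≥0∞) < regenTime Y κ (j + 1) w) → j = i := by
    intro j hj
    by_contra hne
    rcases lt_or_gt_of_ne hne with hlt | hlt
    · exact absurd (hj.2.trans_le ((regenTime_mono Y κ w (Nat.succ_le_of_lt hlt)).trans h.1))
        (lt_irrefl _)
    · exact absurd (h.2.trans_le ((regenTime_mono Y κ w (Nat.succ_le_of_lt hlt)).trans hj.1))
        (lt_irrefl _)
  rw [restorePath, dif_pos hex]
  have := huniq _ (Nat.find_spec hex)
  rw [this]

lemma restorePath_of_lt (Y : RightProcess E Ω) (κ : E → ℝ≥0) {t : ℝ≥0} {w : CycleSpace Ω}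
    (h : (t : ℝ≥0∞) < lifetime Y κ w.1) : restorePath Y κ t w = Y.path t w.1.1 := by
  rw [restorePath_eq Y κ (i := 0) ⟨by simp [regenTime_zero], by simpa [regenTime_one] using h⟩]
  simp [regenTime_zero, cycle]

/-- Regeneration in pathwise form. Divergence of the remaining lifetimes is needed to exclude the
arbitrary value used after an accumulation of regeneration times, which does not respect the shift.
-/
lemma restorePath_of_le (Y : RightProcess E Ω) (κ : E → ℝ≥0) {t : ℝ≥0} {w : CycleSpace Ω}
    (h : lifetime Y κ w.1 ≤ t)
    (hw : ∑' i, lifetime Y κ (cycle (splitSeq w.2) i) = ⊤) :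
    restorePath Y κ t w =
      restorePath Y κ (t - (lifetime Y κ w.1).toNNReal) (splitSeq w.2) := by
  have hfin : lifetime Y κ w.1 ≠ ⊤ := ne_top_of_le_ne_top ENNReal.coe_ne_top h
  obtain ⟨i, hi⟩ := exists_regenTime Y κ hw (t - (lifetime Y κ w.1).toNNReal)
  have hcoe : ((t - (lifetime Y κ w.1).toNNReal : ℝ≥0) : ℝ≥0∞) + lifetime Y κ w.1 = t := by
    rw [ENNReal.coe_sub, ENNReal.coe_toNNReal hfin, tsub_add_cancel_of_le h]
  have h1 : regenTime Y κ (i + 1) w ≤ t ∧ (t : ℝ≥0∞) < regenTime Y κ (i + 1 + 1) w := by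
    rw [regenTime_succ, regenTime_succ, ← hcoe, add_comm _ (lifetime Y κ w.1)]
    exact ⟨by gcongr; exact hi.1, ENNReal.add_lt_add_left hfin hi.2⟩
  have hfin' : regenTime Y κ i (splitSeq w.2) ≠ ⊤ := ne_top_of_le_ne_top ENNReal.coe_ne_top hi.1
  rw [restorePath_eq Y κ hi, restorePath_eq Y κ h1, cycle_splitSeq, regenTime_succ,
    ENNReal.toNNReal_add hfin hfin', tsub_add_eq_tsub_tsub]

lemma ae_lifetime_pos (Y : RightProcess E Ω) {κ : E → ℝ≥0}
    (hκ' : IsLocallyBounded κ) (ν : Measure E) [IsProbabilityMeasure ν] :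
    ∀ᵐ p ∂(cycleLaw Y ν), 0 < lifetime Y κ p := by
  have h : ∀ᵐ p ∂(cycleLaw Y ν), 0 < p.2 :=
    Measure.quasiMeasurePreserving_snd.ae ae_expMeasure_pos
  filter_upwards [h] with p hp
  have := (lt_lifetime_iff Y hκ' p 0).2 (by simpa using hp)
  simpa using this

lemma lintegral_expNeg_lifetime_lt_one (Y : RightProcess E Ω) {κ : E → ℝ≥0}
    (hκ' : IsLocallyBounded κ) (ν : Measure E) [IsProbabilityMeasure ν] :
    ∫⁻ p, expNeg (lifetime Y κ p) ∂(cycleLaw Y ν) < 1 := by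
  have h1 : ∫⁻ p, expNeg (lifetime Y κ p) ∂(cycleLaw Y ν) ≤ 1 := by
    calc _ ≤ ∫⁻ _, 1 ∂(cycleLaw Y ν) := lintegral_mono fun p => expNeg_le_one _
      _ = 1 := by simp
  have := lintegral_strict_mono (IsProbabilityMeasure.ne_zero (cycleLaw Y ν))
    (f := fun p => expNeg (lifetime Y κ p)) (g := fun _ => 1) aemeasurable_const
    (ne_top_of_le_ne_top ENNReal.one_ne_top h1)
    ((ae_lifetime_pos Y hκ' ν).mono fun p hp => expNeg_lt_one hp)
  simpa using this

variable [BorelSpace E]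

lemma measurable_regenTime (Y : RightProcess E Ω) {κ : E → ℝ≥0} (hκ : Measurable κ)
    (hκ' : IsLocallyBounded κ) (n : ℕ) : Measurable (regenTime Y κ n) :=
  Finset.measurable_sum _ fun i _ => (measurable_lifetime Y hκ hκ').comp (measurable_cycle i)

lemma measurable_restorePath (Y : RightProcess E Ω) {κ : E → ℝ≥0} (hκ : Measurable κ)
    (hκ' : IsLocallyBounded κ) :
    Measurable (fun p : ℝ≥0 × CycleSpace Ω => restorePath Y κ p.1 p.2) := by
  let S : ℕ → Set (ℝ≥0 × CycleSpace Ω) := fun i =>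
    {p | regenTime Y κ i p.2 ≤ p.1 ∧ (p.1 : ℝ≥0∞) < regenTime Y κ (i + 1) p.2}
  have hT : ∀ i, Measurable fun p : ℝ≥0 × CycleSpace Ω => regenTime Y κ i p.2 := fun i =>
    (measurable_regenTime Y hκ hκ' i).comp measurable_snd
  have hc : Measurable fun p : ℝ≥0 × CycleSpace Ω => (p.1 : ℝ≥0∞) := by fun_prop
  have hS : ∀ i, MeasurableSet (S i) := fun i =>
    (measurableSet_le (hT i) hc).inter (measurableSet_lt hc (hT (i + 1)))
  have hg : ∀ i, Measurable fun p : ℝ≥0 × CycleSpace Ω =>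
      Y.path (p.1 - (regenTime Y κ i p.2).toNNReal) (cycle p.2 i).1 := fun i =>
    Y.measurable_path.comp ((measurable_fst.sub (hT i).ennreal_toNNReal).prodMk
      (measurable_fst.comp ((measurable_cycle i).comp measurable_snd)))
  have hg0 : Measurable fun p : ℝ≥0 × CycleSpace Ω => Y.path p.1 (cycle p.2 0).1 :=
    Y.measurable_path.comp (measurable_fst.prodMk
      (measurable_fst.comp ((measurable_cycle 0).comp measurable_snd)))
  intro B hB
  have e : (fun p : ℝ≥0 × CycleSpace Ω => restorePath Y κ p.1 p.2) ⁻¹' B =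
      (⋃ i, S i ∩ (fun p => Y.path (p.1 - (regenTime Y κ i p.2).toNNReal) (cycle p.2 i).1) ⁻¹' B) ∪
      ((⋃ i, S i)ᶜ ∩ (fun p => Y.path p.1 (cycle p.2 0).1) ⁻¹' B) := by
    ext p
    by_cases hp : ∃ i, p ∈ S i
    · obtain ⟨i, hi⟩ := hp
      simp only [Set.mem_preimage, Set.mem_union, Set.mem_iUnion, Set.mem_inter_iff,
        Set.mem_compl_iff]
      constructor
      · intro h
        exact Or.inl ⟨i, hi, by rwa [restorePath_eq Y κ hi] at h⟩
      · rintro (⟨j, hj, h⟩ | ⟨h, -⟩)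
        · rwa [restorePath_eq Y κ hj]
        · exact absurd ⟨i, hi⟩ h
    · have hp' : ¬ ∃ i, regenTime Y κ i p.2 ≤ p.1 ∧ (p.1 : ℝ≥0∞) < regenTime Y κ (i + 1) p.2 := hp
      simp only [Set.mem_preimage, Set.mem_union, Set.mem_iUnion, Set.mem_inter_iff,
        Set.mem_compl_iff, hp, restorePath, dif_neg hp', not_false_eq_true, true_and]
      constructor
      · exact Or.inr
      · rintro (⟨j, hj, -⟩ | h)
        · exact absurd ⟨j, hj⟩ hp
        · exact h
  rw [e]
  exact (MeasurableSet.iUnion fun i => (hS i).inter (hg i hB)).union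
    ((MeasurableSet.iUnion hS).compl.inter (hg0 hB))

lemma measurable_restorePath_apply (Y : RightProcess E Ω) {κ : E → ℝ≥0} (hκ : Measurable κ)
    (hκ' : IsLocallyBounded κ) (t : ℝ≥0) : Measurable (restorePath Y κ t) :=
  Measurable.of_uncurry_left (f := fun t w => restorePath Y κ t w) (measurable_restorePath Y hκ hκ')

/-! ### Survival of a cycle -/

lemma cycleLaw_lt_lifetime_inter (Y : RightProcess E Ω) {κ : E → ℝ≥0} (hκ : Measurable κ)
    (hκ' : IsLocallyBounded κ) (ν : Measure E) [IsProbabilityMeasure ν] (t : ℝ≥0) {B : Set E}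
    (hB : MeasurableSet B) :
    cycleLaw Y ν {p | (t : ℝ≥0∞) < lifetime Y κ p ∧ Y.path t p.1 ∈ B} =
      Y.killed κ t B (Y.initLaw ν) := by
  have hm : MeasurableSet {p : Ω × ℝ | (t : ℝ≥0∞) < lifetime Y κ p ∧ Y.path t p.1 ∈ B} :=
    (measurableSet_lt measurable_const (measurable_lifetime Y hκ hκ')).inter
      (((Y.measurable_path_apply t).comp measurable_fst) hB)
  rw [cycleLaw, Measure.prod_apply hm, RCMarkovProcess.killed]
  refine lintegral_congr fun ω => ?_
  by_cases hω : Y.path t ω ∈ B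
  · have : Prod.mk ω ⁻¹' {p : Ω × ℝ | (t : ℝ≥0∞) < lifetime Y κ p ∧ Y.path t p.1 ∈ B} =
        {ξ : ℝ | cumHazard κ (fun s => Y.path s ω) t < ENNReal.ofReal ξ} := by
      ext ξ
      simp [lt_lifetime_iff Y hκ', hω]
    rw [this, expMeasure_lt_ofReal]
    simp [hω, RCMarkovProcess.survival]
  · simp [hω]

lemma cycleLaw_lt_lifetime (Y : RightProcess E Ω) {κ : E → ℝ≥0} (hκ : Measurable κ)
    (hκ' : IsLocallyBounded κ) (ν : Measure E) [IsProbabilityMeasure ν] (t : ℝ≥0) :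
    cycleLaw Y ν {p | (t : ℝ≥0∞) < lifetime Y κ p} = Y.killed κ t Set.univ (Y.initLaw ν) := by
  rw [← cycleLaw_lt_lifetime_inter Y hκ hκ' ν t MeasurableSet.univ]
  simp

lemma measurable_tsum_lifetime (Y : RightProcess E Ω) {κ : E → ℝ≥0} (hκ : Measurable κ)
    (hκ' : IsLocallyBounded κ) :
    Measurable fun w : CycleSpace Ω => ∑' i, lifetime Y κ (cycle w i) :=
  Measurable.tsum fun i => (measurable_lifetime Y hκ hκ').comp (measurable_cycle i)

/-- The regeneration times of the process do not accumulate. -/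
lemma ae_tsum_lifetime_eq_top (Y : RightProcess E Ω) {κ : E → ℝ≥0} (hκ : Measurable κ)
    (hκ' : IsLocallyBounded κ) (μ : Measure E) [IsProbabilityMeasure μ] :
    ∀ᵐ w ∂(restoreMeasure Y μ μ), ∑' i, lifetime Y κ (cycle w i) = ⊤ := by
  have hm : Measurable fun w : CycleSpace Ω => expNeg (∑' i, lifetime Y κ (cycle w i)) :=
    measurable_expNeg.comp (measurable_tsum_lifetime Y hκ hκ')
  set a := ∫⁻ p, expNeg (lifetime Y κ p) ∂(cycleLaw Y μ) with ha
  set z := ∫⁻ w, expNeg (∑' i, lifetime Y κ (cycle w i)) ∂(restoreMeasure Y μ μ) with hz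
  have hz1 : z ≤ 1 := by
    calc z ≤ ∫⁻ _, 1 ∂(restoreMeasure Y μ μ) := lintegral_mono fun w => expNeg_le_one _
      _ = 1 := by simp
  -- Splitting off the first cycle leaves an independent copy of the same sum, so the Laplace
  -- transform `z` is fixed by multiplication with `a < 1`. Hence `z = 0`, and the sum is almost
  -- surely infinite.
  have key : z = a * z := by
    conv_lhs => rw [hz]
    have e : ∀ w : CycleSpace Ω, expNeg (∑' i, lifetime Y κ (cycle w i)) =
        expNeg (lifetime Y κ w.1) *
          expNeg (∑' i, lifetime Y κ (cycle (splitSeq w.2) i)) := by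
      intro w
      rw [← expNeg_add]
      congr 1
      rw [tsum_eq_zero_add' ENNReal.summable]
      simp_rw [cycle_splitSeq]
      rfl
    rw [lintegral_congr e, restoreMeasure_eq, lintegral_prod_mul
      (f := fun p => expNeg (lifetime Y κ p))
      (g := fun x => expNeg (∑' i, lifetime Y κ (cycle (splitSeq x) i)))
      (measurable_expNeg.comp (measurable_lifetime Y hκ hκ')).aemeasurable
      (hm.comp measurable_splitSeq).aemeasurable,
      lintegral_splitSeq Y μ (f := fun w => expNeg (∑' i, lifetime Y κ (cycle w i))) hm]
  have ha1 : a < 1 := lintegral_expNeg_lifetime_lt_one Y hκ' μ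
  have hz0 : z = 0 := by
    by_contra h0
    have : a * z < 1 * z :=
      ENNReal.mul_lt_mul_left h0 (ne_top_of_le_ne_top ENNReal.one_ne_top hz1) ha1
    rw [← key, one_mul] at this
    exact lt_irrefl _ this
  rw [hz, lintegral_eq_zero_iff hm] at hz0
  filter_upwards [hz0] with w hw
  exact expNeg_eq_zero.1 hw

/-! ### The renewal equation -/

lemma restoreLaw_apply (Y : RightProcess E Ω) {κ : E → ℝ≥0} (hκ : Measurable κ)
    (hκ' : IsLocallyBounded κ) (μ ν : Measure E) [IsProbabilityMeasure μ]
    [IsProbabilityMeasure ν] (t : ℝ≥0) {B : Set E} (hB : MeasurableSet B) :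
    restoreLaw Y κ μ ν t B = restoreMeasure Y μ ν (restorePath Y κ t ⁻¹' B) :=
  Measure.map_apply (measurable_restorePath_apply Y hκ hκ' t) hB

lemma isProbabilityMeasure_restoreLaw (Y : RightProcess E Ω) {κ : E → ℝ≥0} (hκ : Measurable κ)
    (hκ' : IsLocallyBounded κ) (μ ν : Measure E) [IsProbabilityMeasure μ]
    [IsProbabilityMeasure ν] (t : ℝ≥0) : IsProbabilityMeasure (restoreLaw Y κ μ ν t) :=
  Measure.isProbabilityMeasure_map (measurable_restorePath_apply Y hκ hκ' t).aemeasurable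

lemma measurable_restoreLaw (Y : RightProcess E Ω) {κ : E → ℝ≥0} (hκ : Measurable κ)
    (hκ' : IsLocallyBounded κ) (μ ν : Measure E) [IsProbabilityMeasure μ]
    [IsProbabilityMeasure ν] {B : Set E} (hB : MeasurableSet B) :
    Measurable fun t => restoreLaw Y κ μ ν t B := by
  simp_rw [restoreLaw_apply Y hκ hκ' μ ν _ hB]
  exact measurable_measure_prodMk_left (measurable_restorePath Y hκ hκ' hB)

/-- Condition on the first cycle. If it outlives `t`, the process is still `Y`; otherwise the
remaining cycles form a Restore process started from `μ`, independent of the first cycle. -/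
lemma restoreLaw_renewal (Y : RightProcess E Ω) {κ : E → ℝ≥0} (hκ : Measurable κ)
    (hκ' : IsLocallyBounded κ) (μ ν : Measure E) [IsProbabilityMeasure μ]
    [IsProbabilityMeasure ν] (t : ℝ≥0) {B : Set E} (hB : MeasurableSet B) :
    restoreLaw Y κ μ ν t B = Y.killed κ t B (Y.initLaw ν) +
      ∫⁻ p in {p | lifetime Y κ p ≤ t},
        restoreLaw Y κ μ μ (t - (lifetime Y κ p).toNNReal) B ∂(cycleLaw Y ν) := by
  have hL := measurable_lifetime Y hκ hκ'
  have hle : MeasurableSet {p : Ω × ℝ | lifetime Y κ p ≤ t} := measurableSet_le hL measurable_const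
  have hX := measurable_restorePath_apply Y hκ hκ' t hB
  have hae : ∀ᵐ z ∂(Measure.infinitePi fun _ : ℕ => cycleLaw Y μ),
      ∑' i, lifetime Y κ (cycle (splitSeq z) i) = ⊤ := by
    have := ae_tsum_lifetime_eq_top Y hκ hκ' μ
    rw [restoreMeasure_eq, ← map_splitSeq] at this
    exact ae_of_ae_map measurable_splitSeq.aemeasurable this
  rw [restoreLaw_apply Y hκ hκ' μ ν t hB, restoreMeasure_eq, Measure.prod_apply hX,
    ← lintegral_add_compl _ hle, add_comm]
  congr 1
  · rw [← cycleLaw_lt_lifetime_inter Y hκ hκ' ν t hB]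
    have hB' : MeasurableSet {p : Ω × ℝ | Y.path t p.1 ∈ B} :=
      ((Y.measurable_path_apply t).comp measurable_fst) hB
    have e : {p : Ω × ℝ | (t : ℝ≥0∞) < lifetime Y κ p ∧ Y.path t p.1 ∈ B} =
        {p : Ω × ℝ | Y.path t p.1 ∈ B} ∩ {p : Ω × ℝ | lifetime Y κ p ≤ t}ᶜ := by
      ext p; simp [and_comm]
    rw [e, ← Measure.restrict_apply hB', ← lintegral_indicator_one hB']
    refine setLIntegral_congr_fun hle.compl fun p hp => ?_
    have hp' : (t : ℝ≥0∞) < lifetime Y κ p := not_le.1 hp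
    by_cases hpB : Y.path t p.1 ∈ B
    · have : Prod.mk p ⁻¹' (restorePath Y κ t ⁻¹' B) = Set.univ := by
        ext z
        simp [restorePath_of_lt Y κ (w := (p, z)) hp', hpB]
      simp [this, hpB]
    · have : Prod.mk p ⁻¹' (restorePath Y κ t ⁻¹' B) = ∅ := by
        ext z
        simp [restorePath_of_lt Y κ (w := (p, z)) hp', hpB]
      simp [this, hpB]
  · refine setLIntegral_congr_fun hle fun p hp => ?_
    have hp' : lifetime Y κ p ≤ t := hp
    rw [restoreLaw_apply Y hκ hκ' μ μ _ hB, restoreMeasure_eq Y μ μ, ← map_splitSeq,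
      Measure.map_apply measurable_splitSeq (measurable_restorePath_apply Y hκ hκ' _ hB)]
    refine measure_congr ?_
    filter_upwards [hae] with z hz
    have := restorePath_of_le Y κ (w := (p, z)) hp' hz
    exact congrArg (· ∈ B) this

end Construction

/-! ### Exponential thinning of a distribution on the half-line -/

section Thinning

lemma lintegral_expMeasure {c : ℝ} (φ : ℝ → ℝ≥0∞) (hφ : Measurable φ) :
    ∫⁻ r, φ r ∂(expMeasure c) =
      ∫⁻ r in Set.Ici 0, ENNReal.ofReal (c * Real.exp (-(c * r))) * φ r := by
  have hm : Measurable (gammaPDF 1 c) := (measurable_gammaPDFReal 1 c).ennreal_ofReal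
  rw [expMeasure, gammaMeasure, lintegral_withDensity_eq_lintegral_mul _ hm hφ,
    ← lintegral_indicator measurableSet_Ici]
  refine lintegral_congr fun r => ?_
  change exponentialPDF c r * φ r = _
  rw [exponentialPDF_eq]
  by_cases hr : 0 ≤ r
  · simp [hr]
  · simp [hr]

/-- The density `e^{-cs}`. -/
noncomputable def expDensity (c s : ℝ) : ℝ≥0∞ := ENNReal.ofReal (Real.exp (-(c * s)))

@[fun_prop]
lemma measurable_expDensity (c : ℝ) : Measurable (expDensity c) := by
  unfold expDensity; fun_prop

lemma expDensity_add (c s t : ℝ) : expDensity c (s + t) = expDensity c s * expDensity c t := by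
  rw [expDensity, expDensity, expDensity, ← ENNReal.ofReal_mul (Real.exp_nonneg _), ← Real.exp_add]
  congr 2; ring

lemma lintegral_expMeasure_eq {c : ℝ} (hc : 0 < c) (φ : ℝ → ℝ≥0∞) (hφ : Measurable φ) :
    ∫⁻ r, φ r ∂(expMeasure c) =
      ∫⁻ r in Set.Ici 0, ENNReal.ofReal c * (expDensity c r * φ r) := by
  rw [lintegral_expMeasure φ hφ]
  refine lintegral_congr fun r => ?_
  rw [ENNReal.ofReal_mul hc.le, mul_assoc]; rfl

variable {c : ℝ} {F G : Measure ℝ} {H K : ℝ → ℝ≥0∞}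

/-- An exponential time is the minimum of itself and an independent time with distribution `G` and
survival function `K`, followed by an independent exponential time in case the minimum is the
latter. -/
lemma lintegral_expMeasure_decomp (hc : 0 < c) [IsFiniteMeasure G] (hG0 : G (Set.Iio 0) = 0)
    (hK : Measurable K) (hGK : ∀ t, 0 ≤ t → G (Set.Iic t) + K t = 1)
    (φ : ℝ → ℝ≥0∞) (hφ : Measurable φ) :
    ∫⁻ r, φ r ∂(expMeasure c) =
      (∫⁻ r in Set.Ici 0, ENNReal.ofReal c * (expDensity c r * K r) * φ r) +
      ∫⁻ y, ∫⁻ x, φ (y + x) ∂(expMeasure c) ∂(G.withDensity (expDensity c)) := by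
  have := isProbabilityMeasure_expMeasure hc
  have hm2 : Measurable fun p : ℝ × ℝ => φ (p.1 + p.2) := hφ.comp measurable_add
  have hin : Measurable fun y => ∫⁻ x, φ (y + x) ∂(expMeasure c) := hm2.lintegral_prod_right'
  have hGm : Measurable fun r => G (Set.Iic r) :=
    Monotone.measurable fun a b h => measure_mono (Set.Iic_subset_Iic.2 h)
  -- Memorylessness: the weight `e^{-cy}` times an Exp(c) density shifted by `y` is that density
  -- restricted to `[y, ∞)`.
  have e1 : ∀ y, expDensity c y * ∫⁻ x, φ (y + x) ∂(expMeasure c) =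
      ∫⁻ r, (Set.Ici y).indicator (fun r => ENNReal.ofReal c * (expDensity c r * φ r)) r := by
    intro y
    rw [lintegral_expMeasure_eq hc (fun x => φ (y + x)) (hφ.comp (measurable_const_add y)),
      ← lintegral_const_mul _ (by fun_prop), ← lintegral_indicator measurableSet_Ici,
      ← lintegral_add_left_eq_self ((Set.Ici y).indicator
        fun r => ENNReal.ofReal c * (expDensity c r * φ r)) y]
    refine lintegral_congr fun x => ?_
    by_cases hx : 0 ≤ x
    · have h1 : y + x ∈ Set.Ici y := by simpa using hx
      have h2 : x ∈ Set.Ici (0 : ℝ) := hx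
      rw [Set.indicator_of_mem h1, Set.indicator_of_mem h2, expDensity_add]
      ring
    · have h1 : y + x ∉ Set.Ici y := by simpa using hx
      have h2 : x ∉ Set.Ici (0 : ℝ) := hx
      rw [Set.indicator_of_notMem h1, Set.indicator_of_notMem h2]
  have e2 : ∫⁻ y, ∫⁻ x, φ (y + x) ∂(expMeasure c) ∂(G.withDensity (expDensity c)) =
      ∫⁻ r in Set.Ici 0, ENNReal.ofReal c * (expDensity c r * φ r) * G (Set.Iic r) := by
    rw [lintegral_withDensity_eq_lintegral_mul _ (measurable_expDensity c) hin]
    simp only [Pi.mul_apply]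
    rw [lintegral_congr e1, lintegral_lintegral_swap, ← lintegral_indicator measurableSet_Ici]
    · refine lintegral_congr fun r => ?_
      have e3 : ∀ y, (Set.Ici y).indicator (fun r => ENNReal.ofReal c * (expDensity c r * φ r)) r =
          (Set.Iic r).indicator (fun _ => ENNReal.ofReal c * (expDensity c r * φ r)) y := by
        intro y
        simp [Set.indicator_apply]
      simp_rw [e3]
      rw [lintegral_indicator_const measurableSet_Iic]
      by_cases hr : 0 ≤ r
      · rw [Set.indicator_of_mem (Set.mem_Ici.2 hr)]
      · have : G (Set.Iic r) = 0 := measure_mono_null (fun x hx =>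
          lt_of_le_of_lt (Set.mem_Iic.1 hx) (not_le.1 hr)) hG0
        rw [Set.indicator_of_notMem (by simpa using hr), this, mul_zero]
    · refine Measurable.aemeasurable ?_
      have : (Function.uncurry fun y r =>
          (Set.Ici y).indicator (fun r => ENNReal.ofReal c * (expDensity c r * φ r)) r) =
          {p : ℝ × ℝ | p.1 ≤ p.2}.indicator
            (fun p => ENNReal.ofReal c * (expDensity c p.2 * φ p.2)) := by
        ext p
        simp [Set.indicator_apply, Function.uncurry]
      rw [this]
      exact Measurable.indicator (by fun_prop) (measurableSet_le measurable_fst measurable_snd)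
  rw [e2, lintegral_expMeasure_eq hc φ hφ, ← lintegral_add_left (by fun_prop)]
  refine setLIntegral_congr_fun measurableSet_Ici fun r hr => ?_
  have := hGK r hr
  calc ENNReal.ofReal c * (expDensity c r * φ r)
      = ENNReal.ofReal c * (expDensity c r * φ r) * (G (Set.Iic r) + K r) := by rw [this, mul_one]
    _ = _ := by ring

/-- The distribution of the minimum of an exponential time and an independent time with
distribution `G` and survival function `K`. -/
lemma eq_thinning (hc : 0 < c) [IsFiniteMeasure F] [IsFiniteMeasure G] (hF0 : F (Set.Iio 0) = 0)
    (hG0 : G (Set.Iio 0) = 0) (hK : Measurable K)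
    (hFH : ∀ t, 0 ≤ t → F (Set.Iic t) + H t = 1) (hGK : ∀ t, 0 ≤ t → G (Set.Iic t) + K t = 1)
    (hHK : ∀ t, 0 ≤ t → H t = expDensity c t * K t) :
    F = (volume.restrict (Set.Ici 0)).withDensity
        (fun r => ENNReal.ofReal c * (expDensity c r * K r)) + G.withDensity (expDensity c) := by
  have := isProbabilityMeasure_expMeasure hc
  refine Measure.ext_of_Iic _ _ fun t => ?_
  have hN : Measurable fun r => ENNReal.ofReal c * (expDensity c r * K r) := by fun_prop
  rw [Measure.add_apply, withDensity_apply _ measurableSet_Iic,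
    withDensity_apply _ measurableSet_Iic, Measure.restrict_restrict measurableSet_Iic]
  rcases lt_or_ge t 0 with ht | ht
  · have h1 : Set.Iic t ⊆ Set.Iio 0 := fun x hx => lt_of_le_of_lt hx ht
    have h2 : Set.Iic t ∩ Set.Ici 0 = ∅ := by
      ext x; simp only [Set.mem_inter_iff, Set.mem_Iic, Set.mem_Ici, Set.mem_empty_iff_false,
        iff_false, not_and, not_le]
      intro hx; linarith
    rw [measure_mono_null h1 hF0, h2, Measure.restrict_eq_zero.2 (measure_mono_null h1 hG0)]
    simp
  · have hdec := lintegral_expMeasure_decomp hc hG0 hK hGK ((Set.Iic t).indicator 1)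
      (measurable_one.indicator measurableSet_Iic)
    rw [lintegral_indicator_one measurableSet_Iic, expMeasure_Iic hc, if_pos ht] at hdec
    have hN' : ∫⁻ r in Set.Ici 0, ENNReal.ofReal c * (expDensity c r * K r) *
        (Set.Iic t).indicator 1 r =
        ∫⁻ r in Set.Iic t ∩ Set.Ici 0, ENNReal.ofReal c * (expDensity c r * K r) := by
      rw [← Measure.restrict_restrict measurableSet_Iic, ← lintegral_indicator measurableSet_Iic]
      refine lintegral_congr fun r => ?_
      by_cases hr : r ∈ Set.Iic t <;> simp [hr]
    have hin : ∀ y, ∫⁻ x, (Set.Iic t).indicator 1 (y + x) ∂(expMeasure c) =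
        expMeasure c (Set.Iic (t - y)) := by
      intro y
      rw [← lintegral_indicator_one measurableSet_Iic]
      refine lintegral_congr fun x => ?_
      simp [Set.indicator_apply, le_sub_iff_add_le']
    have hinm : Measurable fun y => expMeasure c (Set.Iic (t - y)) :=
      Antitone.measurable fun a b h => measure_mono (Set.Iic_subset_Iic.2 (by linarith))
    simp_rw [hin] at hdec
    rw [hN', lintegral_withDensity_eq_lintegral_mul _ (measurable_expDensity c) hinm] at hdec
    have hfin : H t ≠ ⊤ := by
      intro h; have := hFH t ht; rw [h, add_top] at this; exact ENNReal.top_ne_one this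
    -- A clock silent at time `y` either rings between `y` and `t` or is still silent at `t`:
    -- `e^{-cy} = e^{-cy} (1 - e^{-c(t-y)}) + e^{-ct}`.
    have hsum : ∫⁻ y in Set.Iic t, expDensity c y ∂G =
        (∫⁻ y, (expDensity c * fun y => expMeasure c (Set.Iic (t - y))) y ∂G) +
          expDensity c t * G (Set.Iic t) := by
      rw [← lintegral_indicator measurableSet_Iic, ← lintegral_indicator_const measurableSet_Iic,
        ← lintegral_add_right _ (measurable_const.indicator measurableSet_Iic)]
      refine lintegral_congr fun y => ?_
      by_cases hy : y ≤ t
      · have hy' : 0 ≤ t - y := by linarith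
        have : expMeasure c (Set.Iic (t - y)) + expDensity c (t - y) = 1 := by
          rw [expMeasure_Iic hc, if_pos hy', expDensity, ← ENNReal.ofReal_add]
          · simp
          · simp; positivity
          · positivity
        have e : expDensity c t = expDensity c y * expDensity c (t - y) := by
          rw [← expDensity_add]; congr 1; ring
        simp only [Pi.mul_apply, Set.indicator_of_mem (Set.mem_Iic.2 hy)]
        rw [e, ← mul_add, this, mul_one]
      · have hy' : ¬ 0 ≤ t - y := by linarith
        have hy2 : y ∉ Set.Iic t := hy
        simp only [Pi.mul_apply, Set.indicator_of_notMem hy2, expMeasure_Iic hc, if_neg hy']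
        simp
    have hone : ENNReal.ofReal (1 - Real.exp (-(c * t))) + expDensity c t = 1 := by
      rw [expDensity, ← ENNReal.ofReal_add]
      · simp
      · simp; positivity
      · positivity
    rw [← ENNReal.add_left_inj hfin, hFH t ht, hsum, ← add_assoc, ← hdec, hHK t ht, add_assoc,
      ← mul_add, hGK t ht, mul_one, hone]

/-- The residual time is positive, so the clock rings before it with positive probability. This
strict inequality drives the geometric decay in the iteration. -/
lemma withDensity_expDensity_lt_one (hc : 0 < c) (hG0 : G (Set.Iic 0) = 0)
    (hG1 : G Set.univ ≤ 1) : G.withDensity (expDensity c) Set.univ < 1 := by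
  rw [withDensity_apply _ MeasurableSet.univ, Measure.restrict_univ]
  by_cases hG : G = 0
  · simp [hG]
  · have hpos : ∀ᵐ s ∂G, 0 < s := by
      rw [ae_iff]; simpa [Set.Iic] using hG0
    have hlt : ∀ᵐ s ∂G, expDensity c s < 1 := by
      filter_upwards [hpos] with s hs
      rw [expDensity, ENNReal.ofReal_lt_one, Real.exp_lt_one_iff]
      have := mul_pos hc hs
      linarith
    have hle : ∫⁻ s, expDensity c s ∂G ≤ G Set.univ := by
      rw [← lintegral_one]
      exact lintegral_mono_ae (hlt.mono fun s hs => hs.le)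
    have := lintegral_strict_mono hG (f := expDensity c) (g := fun _ => 1) aemeasurable_const
      (ne_top_of_le_ne_top ENNReal.one_ne_top (hle.trans hG1)) hlt
    rw [lintegral_one] at this
    exact this.trans_le hG1

/-- A bounded function dominating its convolution with `F = N + F'` dominates its convolution with
an exponential distribution `e`, if `e = N + e ∗ F'` and `F'` has mass less than one. -/
lemma lintegral_sub_expMeasure_le {N F' : Measure ℝ}
    (hdec : ∀ φ : ℝ → ℝ≥0∞, Measurable φ → ∫⁻ r, φ r ∂(expMeasure c) =
      (∫⁻ r, φ r ∂N) + ∫⁻ y, ∫⁻ x, φ (y + x) ∂(expMeasure c) ∂F')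
    (hc : 0 < c) (hq : F' Set.univ < 1) {u : ℝ → ℝ≥0∞} (hu : Measurable u) (hu1 : ∀ t, u t ≤ 1)
    (huF : ∀ t, ∫⁻ s, u (t - s) ∂(N + F') ≤ u t) (t : ℝ) :
    ∫⁻ s, u (t - s) ∂(expMeasure c) ≤ u t := by
  have := isProbabilityMeasure_expMeasure hc
  have hsub : ∀ t : ℝ, Measurable fun s => u (t - s) := fun t => by fun_prop
  -- The trivial bound `u * e ≤ 1` starts the iteration. Each use of `e = N + F' * e` integrates the
  -- previous error against `F'`, multiplying it by the mass of `F'`.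
  have key : ∀ (n : ℕ) (t : ℝ), ∫⁻ s, u (t - s) ∂(expMeasure c) ≤ u t + (F' Set.univ) ^ n := by
    intro n
    induction n with
    | zero =>
      intro t
      calc ∫⁻ s, u (t - s) ∂(expMeasure c) ≤ ∫⁻ _, 1 ∂(expMeasure c) :=
            lintegral_mono fun s => hu1 _
        _ = 1 := by simp
        _ ≤ u t + (F' Set.univ) ^ 0 := by simp
    | succ n ih =>
      intro t
      rw [hdec _ (hsub t)]
      calc (∫⁻ r, u (t - r) ∂N) + ∫⁻ y, ∫⁻ x, u (t - (y + x)) ∂(expMeasure c) ∂F'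
          ≤ (∫⁻ r, u (t - r) ∂N) + ∫⁻ y, (u (t - y) + (F' Set.univ) ^ n) ∂F' := by
            gcongr with y
            simp_rw [← sub_sub]
            exact ih (t - y)
        _ = (∫⁻ s, u (t - s) ∂(N + F')) + (F' Set.univ) ^ (n + 1) := by
            rw [lintegral_add_right _ measurable_const, lintegral_const, lintegral_add_measure,
              add_assoc, pow_succ]
        _ ≤ u t + (F' Set.univ) ^ (n + 1) := by gcongr; exact huF t
  have hlim : Tendsto (fun n : ℕ => u t + (F' Set.univ) ^ n) atTop (𝓝 (u t + 0)) :=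
    tendsto_const_nhds.add (ENNReal.tendsto_pow_atTop_nhds_zero_of_lt_one hq)
  rw [add_zero] at hlim
  exact ge_of_tendsto' hlim fun n => key n t

end Thinning

/-! ### Survival functions and the integrated renewal equation -/

section RenewalIdentity

variable {F : Measure ℝ} {H : ℝ → ℝ≥0∞}

lemma eq_of_survival_eq {G : Measure ℝ} [IsFiniteMeasure F] (hF0 : F (Set.Iio 0) = 0)
    (hG0 : G (Set.Iio 0) = 0) (hFH : ∀ t, 0 ≤ t → F (Set.Iic t) + H t = 1)
    (hGH : ∀ t, 0 ≤ t → G (Set.Iic t) + H t = 1) : F = G := by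
  refine Measure.ext_of_Iic _ _ fun t => ?_
  rcases lt_or_ge t 0 with ht | ht
  · have h1 : Set.Iic t ⊆ Set.Iio 0 := fun x hx => lt_of_le_of_lt hx ht
    rw [measure_mono_null h1 hF0, measure_mono_null h1 hG0]
  · have hfin : H t ≠ ⊤ := by
      intro h; have := hFH t ht; rw [h, add_top] at this; exact ENNReal.top_ne_one this
    rw [← ENNReal.add_left_inj hfin, hFH t ht, hGH t ht]

/-- If `u = g + F * u`, then `(1 - F) * u = g` after integration. -/
lemma lintegral_survival_mul_eq [IsFiniteMeasure F] (hF0 : F (Set.Iio 0) = 0)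
    (hFH : ∀ t, 0 ≤ t → F (Set.Iic t) + H t = 1) {u g : ℝ → ℝ≥0∞} (hu : Measurable u)
    (hg : Measurable g) (hu0 : ∀ t < 0, u t = 0) (hu1 : ∀ t, u t ≤ 1)
    (hren : ∀ t, 0 ≤ t → u t = g t + ∫⁻ s, u (t - s) ∂F) (t : ℝ) :
    ∫⁻ s in Set.Ici 0, H s * u (t - s) = ∫⁻ r in Set.Icc 0 t, g r := by
  have hFm : Measurable fun r => F (Set.Iic (t - r)) :=
    Antitone.measurable fun a b h => measure_mono (Set.Iic_subset_Iic.2 (by linarith))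
  have hsub : Measurable fun p : ℝ × ℝ => u (p.1 - p.2) := hu.comp measurable_sub
  have h1 : ∫⁻ s in Set.Ici 0, H s * u (t - s) = ∫⁻ r in Set.Icc 0 t, u r * H (t - r) := by
    rw [← lintegral_indicator measurableSet_Ici, ← lintegral_indicator measurableSet_Icc,
      ← lintegral_sub_left_eq_self _ t]
    refine lintegral_congr fun r => ?_
    by_cases hr : r ∈ Set.Icc 0 t
    · have : t - r ∈ Set.Ici (0 : ℝ) := by simpa using hr.2
      rw [Set.indicator_of_mem this, Set.indicator_of_mem hr, sub_sub_cancel, mul_comm]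
    · rw [Set.indicator_of_notMem hr]
      by_cases h : t - r ∈ Set.Ici (0 : ℝ)
      · have hr0 : r < 0 := by
          by_contra h0
          exact hr ⟨not_lt.1 h0, by simpa using h⟩
        rw [Set.indicator_of_mem h, sub_sub_cancel, hu0 r hr0, mul_zero]
      · rw [Set.indicator_of_notMem h]
  -- Fubini after the shift `r ↦ r + s`. Since `u` vanishes at negative times and `F` does not
  -- charge them, the condition left on `s` is `s ≤ t - r`.
  have h2 : ∫⁻ r in Set.Icc 0 t, ∫⁻ s, u (r - s) ∂F =
      ∫⁻ r in Set.Icc 0 t, u r * F (Set.Iic (t - r)) := by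
    rw [lintegral_lintegral_swap hsub.aemeasurable]
    have hpos : ∀ᵐ s ∂F, 0 ≤ s := by
      rw [ae_iff]; simpa [Set.Iio] using hF0
    have e1 : ∀ᵐ s ∂F, ∫⁻ r in Set.Icc 0 t, u (r - s) =
        ∫⁻ r, (Set.Iic (t - r)).indicator (fun _ => u r) s := by
      filter_upwards [hpos] with s hs
      rw [← lintegral_indicator measurableSet_Icc, ← lintegral_add_right_eq_self _ s]
      refine lintegral_congr fun r => ?_
      by_cases hr : 0 ≤ r
      · have : r + s ∈ Set.Icc 0 t ↔ s ∈ Set.Iic (t - r) := by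
          simp only [Set.mem_Icc, Set.mem_Iic]
          constructor
          · intro h; linarith [h.2]
          · intro h; constructor <;> linarith
        by_cases h : r + s ∈ Set.Icc 0 t
        · rw [Set.indicator_of_mem h, Set.indicator_of_mem (this.1 h), add_sub_cancel_right]
        · rw [Set.indicator_of_notMem h, Set.indicator_of_notMem fun h' => h (this.2 h')]
      · have h0 := hu0 r (not_le.1 hr)
        simp [Set.indicator_apply, h0]
    rw [lintegral_congr_ae e1, lintegral_lintegral_swap, ← lintegral_indicator measurableSet_Icc]
    · refine lintegral_congr fun r => ?_
      rw [lintegral_indicator_const measurableSet_Iic]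
      by_cases hr : r ∈ Set.Icc 0 t
      · rw [Set.indicator_of_mem hr]
      · rw [Set.indicator_of_notMem hr]
        by_cases hr0 : r < 0
        · rw [hu0 r hr0, zero_mul]
        · have hlt : t - r < 0 := by
            by_contra h
            exact hr ⟨not_lt.1 hr0, by linarith⟩
          rw [measure_mono_null (fun x hx => lt_of_le_of_lt (Set.mem_Iic.1 hx) hlt) hF0, mul_zero]
    · refine Measurable.aemeasurable ?_
      have : (Function.uncurry fun s r => (Set.Iic (t - r)).indicator (fun _ => u r) s) =
          {p : ℝ × ℝ | p.1 ≤ t - p.2}.indicator (fun p => u p.2) := by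
        ext p
        simp [Set.indicator_apply, Function.uncurry]
      rw [this]
      exact Measurable.indicator (by fun_prop) (measurableSet_le (by fun_prop) (by fun_prop))
  have h3 : ∫⁻ r in Set.Icc 0 t, u r =
      (∫⁻ r in Set.Icc 0 t, g r) + ∫⁻ r in Set.Icc 0 t, u r * F (Set.Iic (t - r)) := by
    rw [← h2, ← lintegral_add_left hg]
    exact setLIntegral_congr_fun measurableSet_Icc fun r hr => hren r hr.1
  -- Splitting `1 = H + F` at `t - r` gives a second expression for `∫ u`. Cancelling the term
  -- common with `h3`, which is finite because `u ≤ 1`, leaves the identity.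
  have h4 : ∫⁻ r in Set.Icc 0 t, u r =
      (∫⁻ r in Set.Icc 0 t, u r * H (t - r)) + ∫⁻ r in Set.Icc 0 t, u r * F (Set.Iic (t - r)) := by
    rw [← lintegral_add_right _ (show Measurable fun r => u r * F (Set.Iic (t - r)) from hu.mul hFm)]
    refine setLIntegral_congr_fun measurableSet_Icc fun r hr => ?_
    have := hFH (t - r) (by linarith [hr.2])
    rw [← mul_add, add_comm, this, mul_one]
  have hfin : ∫⁻ r in Set.Icc 0 t, u r * F (Set.Iic (t - r)) ≠ ⊤ := by
    have hle : ∫⁻ r in Set.Icc 0 t, u r * F (Set.Iic (t - r)) ≤ ∫⁻ r in Set.Icc 0 t, u r := by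
      rw [h3]; exact le_add_self
    have hle2 : ∫⁻ r in Set.Icc 0 t, u r ≤ ∫⁻ _ in Set.Icc 0 t, 1 :=
      lintegral_mono fun r => hu1 r
    refine ne_top_of_le_ne_top ?_ (hle.trans hle2)
    simp
  rw [h1]
  rw [h3] at h4
  exact ((ENNReal.add_left_inj hfin).1 h4).symm

end RenewalIdentity

/-- The truncated subtraction `κ - c` is a true subtraction at almost every time, by the lower bound
along the path. -/
lemma cumHazard_eq_add {E : Type*} (κ : E → ℝ≥0) {w : ℝ≥0 → E} (c : ℝ≥0)
    (h : ∀ᵐ s ∂(volume.restrict (Set.Ici (0 : ℝ))), c ≤ κ (w s.toNNReal)) (t : ℝ≥0) :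
    cumHazard κ w t = ENNReal.ofReal (c * t) + cumHazard (fun x => κ x - c) w t := by
  have hle : volume.restrict (Set.Icc (0 : ℝ) t) ≤ volume.restrict (Set.Ici 0) :=
    Measure.restrict_mono Set.Icc_subset_Ici_self le_rfl
  have e : cumHazard κ w t =
      ∫⁻ s in Set.Icc (0 : ℝ) t, ((c : ℝ≥0∞) + ((κ (w s.toNNReal) - c : ℝ≥0) : ℝ≥0∞)) := by
    refine lintegral_congr_ae ?_
    filter_upwards [ae_mono hle h] with s hs
    rw [← ENNReal.coe_add, add_tsub_cancel_of_le hs]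
  rw [e, lintegral_add_left measurable_const, setLIntegral_const, Real.volume_Icc, sub_zero,
    ENNReal.ofReal_mul c.coe_nonneg, ENNReal.ofReal_coe_nnreal, ENNReal.ofReal_coe_nnreal]
  rfl

lemma IsLocallyBounded.tsub {E : Type*} [TopologicalSpace E] {κ : E → ℝ≥0} (hκ : IsLocallyBounded κ) (c : ℝ≥0) :
    IsLocallyBounded fun x => κ x - c := by
  intro x
  obtain ⟨U, hU, C, hC⟩ := hκ x
  refine ⟨U, hU, C, ?_⟩
  rintro _ ⟨y, hy, rfl⟩
  exact tsub_le_self.trans (hC ⟨y, hy, rfl⟩)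

/-! ### The lifetime distribution and the minorisation -/

section LifeLaw

variable {E Ω : Type*} [TopologicalSpace E] [MeasurableSpace E] [MeasurableSpace Ω]

/-- The distribution of the lifetime of a cycle started from `ν`, as a measure on `ℝ`. -/
noncomputable def lifeLaw (Y : RightProcess E Ω) (κ : E → ℝ≥0) (ν : Measure E)
    [IsProbabilityMeasure ν] : Measure ℝ :=
  ((cycleLaw Y ν).restrict {p | lifetime Y κ p < ⊤}).map fun p => (lifetime Y κ p).toReal

instance (Y : RightProcess E Ω) (κ : E → ℝ≥0) (ν : Measure E) [IsProbabilityMeasure ν] :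
    IsFiniteMeasure (lifeLaw Y κ ν) := by unfold lifeLaw; infer_instance

/-- `P_ν(τ > t)`. -/
noncomputable def survivalFn (Y : RightProcess E Ω) (κ : E → ℝ≥0) (ν : Measure E)
    [IsProbabilityMeasure ν] (t : ℝ) : ℝ≥0∞ := Y.killed κ t.toNNReal Set.univ (Y.initLaw ν)

/-- `P_μ(X_t ∈ B)`, extended by zero to negative times. -/
noncomputable def restoreFn (Y : RightProcess E Ω) (κ : E → ℝ≥0) (μ : Measure E)
    [IsProbabilityMeasure μ] (B : Set E) : ℝ → ℝ≥0∞ :=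
  (Set.Ici 0).indicator fun t => restoreLaw Y κ μ μ t.toNNReal B

lemma restoreFn_of_neg (Y : RightProcess E Ω) (κ : E → ℝ≥0) (μ : Measure E)
    [IsProbabilityMeasure μ] (B : Set E) (t : ℝ) (ht : t < 0) : restoreFn Y κ μ B t = 0 :=
  Set.indicator_of_notMem (by simpa using ht) _

lemma survivalFn_zero (Y : RightProcess E Ω) (κ : E → ℝ≥0) (ν : Measure E)
    [IsProbabilityMeasure ν] : survivalFn Y κ ν 0 = 1 := by
  simp [survivalFn, RCMarkovProcess.killed, RCMarkovProcess.survival]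

lemma survivalFn_le_one (Y : RightProcess E Ω) (κ : E → ℝ≥0) (ν : Measure E)
    [IsProbabilityMeasure ν] (t : ℝ) : survivalFn Y κ ν t ≤ 1 := Y.killed_le_one κ _ _ _

/-- Along almost every path, the regeneration rate is at least `c` at almost every time. -/
def RateBoundedBelow (Y : RightProcess E Ω) (κ : E → ℝ≥0) (c : ℝ≥0) : Prop :=
  ∀ x : E, ∀ᵐ ω ∂(Y.law x), ∀ᵐ s ∂(volume.restrict (Set.Ici (0 : ℝ))),
    c ≤ κ (Y.path s.toNNReal ω)

variable [BorelSpace E]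

lemma measurable_survivalFn (Y : RightProcess E Ω) {κ : E → ℝ≥0} (hκ : Measurable κ)
    (ν : Measure E) [IsProbabilityMeasure ν] : Measurable (survivalFn Y κ ν) :=
  (Y.measurable_killed hκ MeasurableSet.univ _).comp measurable_real_toNNReal

lemma measurable_restoreFn (Y : RightProcess E Ω) {κ : E → ℝ≥0} (hκ : Measurable κ)
    (hκ' : IsLocallyBounded κ) (μ : Measure E) [IsProbabilityMeasure μ] {B : Set E}
    (hB : MeasurableSet B) : Measurable (restoreFn Y κ μ B) :=
  ((measurable_restoreLaw Y hκ hκ' μ μ hB).comp measurable_real_toNNReal).indicator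
    measurableSet_Ici

lemma restoreFn_le_one (Y : RightProcess E Ω) {κ : E → ℝ≥0} (hκ : Measurable κ)
    (hκ' : IsLocallyBounded κ) (μ : Measure E) [IsProbabilityMeasure μ] (B : Set E) (t : ℝ) :
    restoreFn Y κ μ B t ≤ 1 := by
  have := isProbabilityMeasure_restoreLaw Y hκ hκ' μ μ t.toNNReal
  exact Set.indicator_apply_le' (fun _ => prob_le_one) fun _ => zero_le

lemma lifeLaw_Iio (Y : RightProcess E Ω) {κ : E → ℝ≥0} (hκ : Measurable κ)
    (hκ' : IsLocallyBounded κ) (ν : Measure E) [IsProbabilityMeasure ν] :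
    lifeLaw Y κ ν (Set.Iio 0) = 0 := by
  rw [lifeLaw, Measure.map_apply (measurable_lifetime Y hκ hκ').ennreal_toReal measurableSet_Iio]
  have : (fun p => (lifetime Y κ p).toReal) ⁻¹' Set.Iio 0 = ∅ := by
    ext p; simp
  rw [this, measure_empty]

lemma lifeLaw_Iic_add (Y : RightProcess E Ω) {κ : E → ℝ≥0} (hκ : Measurable κ)
    (hκ' : IsLocallyBounded κ) (ν : Measure E) [IsProbabilityMeasure ν] (t : ℝ) (ht : 0 ≤ t) :
    lifeLaw Y κ ν (Set.Iic t) + survivalFn Y κ ν t = 1 := by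
  have hL := measurable_lifetime Y hκ hκ'
  rw [survivalFn, ← cycleLaw_lt_lifetime Y hκ hκ', lifeLaw,
    Measure.map_apply hL.ennreal_toReal measurableSet_Iic,
    Measure.restrict_apply (hL.ennreal_toReal measurableSet_Iic)]
  have : (fun p => (lifetime Y κ p).toReal) ⁻¹' Set.Iic t ∩ {p | lifetime Y κ p < ⊤} =
      {p | (t.toNNReal : ℝ≥0∞) < lifetime Y κ p}ᶜ := by
    ext p
    simp only [Set.mem_inter_iff, Set.mem_preimage, Set.mem_Iic, Set.mem_ofPred_eq,
      Set.mem_compl_iff, not_lt]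
    constructor
    · rintro ⟨h1, h2⟩
      rw [← ENNReal.ofReal_toReal h2.ne]
      exact ENNReal.ofReal_le_ofReal h1
    · intro h
      have h2 : lifetime Y κ p ≠ ⊤ := ne_top_of_le_ne_top ENNReal.coe_ne_top h
      refine ⟨?_, h2.lt_top⟩
      exact ENNReal.toReal_le_of_le_ofReal ht h
  rw [this, add_comm]
  exact prob_add_prob_compl (measurableSet_lt measurable_const hL)

lemma lifeLaw_Iic_zero (Y : RightProcess E Ω) {κ : E → ℝ≥0} (hκ : Measurable κ)
    (hκ' : IsLocallyBounded κ) (ν : Measure E) [IsProbabilityMeasure ν] :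
    lifeLaw Y κ ν (Set.Iic 0) = 0 := by
  have := lifeLaw_Iic_add Y hκ hκ' ν 0 le_rfl
  rw [survivalFn_zero] at this
  exact (ENNReal.add_left_inj ENNReal.one_ne_top).1 (this.trans (zero_add 1).symm)

lemma lifeLaw_univ_le (Y : RightProcess E Ω) {κ : E → ℝ≥0} (hκ : Measurable κ)
    (hκ' : IsLocallyBounded κ) (ν : Measure E) [IsProbabilityMeasure ν] :
    lifeLaw Y κ ν Set.univ ≤ 1 := by
  rw [lifeLaw, Measure.map_apply (measurable_lifetime Y hκ hκ').ennreal_toReal MeasurableSet.univ]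
  exact (Measure.restrict_apply_le _ _).trans prob_le_one

lemma restoreLaw_renewal_lifeLaw (Y : RightProcess E Ω) {κ : E → ℝ≥0} (hκ : Measurable κ)
    (hκ' : IsLocallyBounded κ) (μ ν : Measure E) [IsProbabilityMeasure μ]
    [IsProbabilityMeasure ν] {B : Set E} (hB : MeasurableSet B) (t : ℝ) (ht : 0 ≤ t) :
    restoreLaw Y κ μ ν t.toNNReal B = Y.killed κ t.toNNReal B (Y.initLaw ν) +
      ∫⁻ s, restoreFn Y κ μ B (t - s) ∂(lifeLaw Y κ ν) := by
  have hL := measurable_lifetime Y hκ hκ'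
  rw [restoreLaw_renewal Y hκ hκ' μ ν _ hB]
  congr 1
  rw [lifeLaw, lintegral_map (f := fun s => restoreFn Y κ μ B (t - s))
    ((measurable_restoreFn Y hκ hκ' μ hB).comp (measurable_const_sub t))
    hL.ennreal_toReal, ← lintegral_indicator (measurableSet_le hL measurable_const),
    ← lintegral_indicator (measurableSet_lt hL measurable_const)]
  refine lintegral_congr fun p => ?_
  by_cases hp : lifetime Y κ p ≤ t.toNNReal
  · have h2 : lifetime Y κ p ≠ ⊤ := ne_top_of_le_ne_top ENNReal.coe_ne_top hp
    have h3 : (lifetime Y κ p).toReal ≤ t := ENNReal.toReal_le_of_le_ofReal ht hp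
    have h4 : t - (lifetime Y κ p).toReal ∈ Set.Ici (0 : ℝ) := by simpa using h3
    rw [Set.indicator_of_mem (show p ∈ {p | lifetime Y κ p ≤ t.toNNReal} from hp),
      Set.indicator_of_mem (show p ∈ {p | lifetime Y κ p < ⊤} from h2.lt_top), restoreFn,
      Set.indicator_of_mem h4]
    congr 2
    rw [NNReal.sub_def, Real.coe_toNNReal t ht]
    rfl
  · rw [Set.indicator_of_notMem (show p ∉ {p | lifetime Y κ p ≤ t.toNNReal} from hp)]
    by_cases h2 : lifetime Y κ p < ⊤
    · rw [Set.indicator_of_mem (show p ∈ {p | lifetime Y κ p < ⊤} from h2), restoreFn_of_neg]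
      rw [sub_neg]
      have := ENNReal.toReal_strict_mono h2.ne (not_le.1 hp)
      rw [ENNReal.coe_toReal] at this
      exact (Real.le_coe_toNNReal t).trans_lt this
    · rw [Set.indicator_of_notMem (show p ∉ {p | lifetime Y κ p < ⊤} from h2)]

lemma RateBoundedBelow.ae_initLaw {Y : RightProcess E Ω} {κ : E → ℝ≥0} {c : ℝ≥0}
    (h : RateBoundedBelow Y κ c) (hκ : Measurable κ) (ν : Measure E) [IsProbabilityMeasure ν] :
    ∀ᵐ ω ∂(Y.initLaw ν), ∀ᵐ s ∂(volume.restrict (Set.Ici (0 : ℝ))),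
      c ≤ κ (Y.path s.toNNReal ω) := by
  have hm : MeasurableSet {p : Ω × ℝ | κ (Y.path p.2.toNNReal p.1) < c} := by
    have : Measurable fun p : Ω × ℝ => Y.path p.2.toNNReal p.1 := Y.measurable_path.comp
      ((measurable_real_toNNReal.comp measurable_snd).prodMk measurable_fst)
    exact measurableSet_lt (hκ.comp this) measurable_const
  have hm' : MeasurableSet {ω | volume.restrict (Set.Ici (0 : ℝ))
      (Prod.mk ω ⁻¹' {p : Ω × ℝ | κ (Y.path p.2.toNNReal p.1) < c}) = 0} :=
    measurableSet_eq_fun (measurable_measure_prodMk_left hm) measurable_const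
  have e : ∀ ω, (∀ᵐ s ∂(volume.restrict (Set.Ici (0 : ℝ))), c ≤ κ (Y.path s.toNNReal ω)) ↔
      volume.restrict (Set.Ici (0 : ℝ))
        (Prod.mk ω ⁻¹' {p : Ω × ℝ | κ (Y.path p.2.toNNReal p.1) < c}) = 0 := by
    intro ω
    simp only [ae_iff, not_le]
    rfl
  filter_upwards [Y.ae_initLaw ν hm' fun x => (h x).mono fun ω => (e ω).1] with ω hω
  exact (e ω).2 hω

lemma survivalFn_eq {Y : RightProcess E Ω} {κ : E → ℝ≥0} {c : ℝ≥0}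
    (h : RateBoundedBelow Y κ c) (hκ : Measurable κ) (ν : Measure E) [IsProbabilityMeasure ν]
    (t : ℝ) (ht : 0 ≤ t) :
    survivalFn Y κ ν t = expDensity c t * survivalFn Y (fun x => κ x - c) ν t := by
  have hκc : Measurable fun x => κ x - c := hκ.sub_const c
  simp only [survivalFn, RCMarkovProcess.killed]
  rw [← lintegral_const_mul _ (Y.measurable_killed_integrand_apply hκc MeasurableSet.univ _)]
  refine lintegral_congr_ae ?_
  filter_upwards [h.ae_initLaw hκ ν] with ω hω
  simp only [RCMarkovProcess.survival]
  rw [cumHazard_eq_add κ (w := fun s => Y.path s ω) c hω, expNeg_add,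
    expNeg_ofReal (by positivity), Real.coe_toNNReal t ht]
  simp [expDensity]

/-- Domination of the law of the process by the regenerations from an independent exponential
clock. -/
lemma lintegral_restoreFn_le {Y : RightProcess E Ω} {κ : E → ℝ≥0} {c : ℝ≥0}
    (h : RateBoundedBelow Y κ c) (hκ : Measurable κ) (hκ' : IsLocallyBounded κ) (hc : 0 < c)
    (μ ν : Measure E) [IsProbabilityMeasure μ] [IsProbabilityMeasure ν] {B : Set E}
    (hB : MeasurableSet B) (t : ℝ) (ht : 0 ≤ t) :
    ∫⁻ s, restoreFn Y κ μ B (t - s) ∂(expMeasure c) ≤ restoreLaw Y κ μ ν t.toNNReal B := by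
  have hc' : (0 : ℝ) < c := hc
  have hκc : Measurable fun x => κ x - c := hκ.sub_const c
  have hκc' := hκ'.tsub c
  have hu := measurable_restoreFn Y hκ hκ' μ hB
  let N : ∀ (ρ : Measure E) [IsProbabilityMeasure ρ], Measure ℝ := fun ρ _ =>
    (volume.restrict (Set.Ici 0)).withDensity
      (fun r => ENNReal.ofReal c * (expDensity c r * survivalFn Y (fun x => κ x - c) ρ r))
  let F' : ∀ (ρ : Measure E) [IsProbabilityMeasure ρ], Measure ℝ := fun ρ _ =>
    (lifeLaw Y (fun x => κ x - c) ρ).withDensity (expDensity c)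
  have hF : ∀ (ρ : Measure E) [IsProbabilityMeasure ρ], lifeLaw Y κ ρ = N ρ + F' ρ := fun ρ _ =>
    eq_thinning hc' (lifeLaw_Iio Y hκ hκ' ρ) (lifeLaw_Iio Y hκc hκc' ρ)
      (measurable_survivalFn Y hκc ρ) (lifeLaw_Iic_add Y hκ hκ' ρ) (lifeLaw_Iic_add Y hκc hκc' ρ)
      (survivalFn_eq h hκ ρ)
  have hdec : ∀ (ρ : Measure E) [IsProbabilityMeasure ρ] (φ : ℝ → ℝ≥0∞), Measurable φ →
      ∫⁻ r, φ r ∂(expMeasure c) =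
        (∫⁻ r, φ r ∂(N ρ)) + ∫⁻ y, ∫⁻ x, φ (y + x) ∂(expMeasure c) ∂(F' ρ) := by
    intro ρ _ φ hφ
    have hm := measurable_survivalFn Y hκc ρ
    rw [lintegral_expMeasure_decomp hc' (lifeLaw_Iio Y hκc hκc' ρ) hm
      (lifeLaw_Iic_add Y hκc hκc' ρ) φ hφ,
      lintegral_withDensity_eq_lintegral_mul _ (by fun_prop) hφ]
    rfl
  have hq : F' μ Set.univ < 1 := withDensity_expDensity_lt_one hc' (lifeLaw_Iic_zero Y hκc hκc' μ)
    (lifeLaw_univ_le Y hκc hκc' μ)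
  have huF : ∀ t, ∫⁻ s, restoreFn Y κ μ B (t - s) ∂(N μ + F' μ) ≤ restoreFn Y κ μ B t := by
    intro t
    rw [← hF μ]
    rcases lt_or_ge t 0 with ht | ht
    · have hpos : ∀ᵐ s ∂(lifeLaw Y κ μ), 0 ≤ s := by
        rw [ae_iff]; simpa [Set.Iio] using lifeLaw_Iio Y hκ hκ' μ
      refine le_of_eq_of_le (lintegral_eq_zero_of_ae_eq_zero ?_) zero_le
      filter_upwards [hpos] with s hs
      exact restoreFn_of_neg Y κ μ B _ (by linarith)
    · have h1 := restoreLaw_renewal_lifeLaw Y hκ hκ' μ μ hB t ht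
      have h2 : restoreFn Y κ μ B t = restoreLaw Y κ μ μ t.toNNReal B :=
        Set.indicator_of_mem (Set.mem_Ici.2 ht) _
      rw [h2, h1]
      exact le_add_self
  -- The comparison is first closed for cycles started from `μ`. For `ν`, drop the survival term of
  -- the renewal equation, split the first lifetime, and apply the comparison after a residual ring.
  have hcmp := lintegral_sub_expMeasure_le (hdec μ) hc' hq hu (restoreFn_le_one Y hκ hκ' μ B) huF
  rw [hdec ν (fun s => restoreFn Y κ μ B (t - s)) (hu.comp (measurable_const_sub t)),
    restoreLaw_renewal_lifeLaw Y hκ hκ' μ ν hB t ht,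
    hF ν, lintegral_add_measure]
  refine le_trans ?_ le_add_self
  gcongr with y
  simp only [← sub_sub]
  exact hcmp (t - y)

end LifeLaw

/-! ### Total variation -/

/-- Each `ρᵢ - m` is a positive measure of mass at most `ε`, so replacing `ρᵢ` by `m` changes the
integral of a function bounded by one by at most `ε`. -/
lemma tvNormSub_le_of_le {E : Type*} [MeasurableSpace E] {ρ₁ ρ₂ m : Measure E}
    [IsProbabilityMeasure ρ₁] [IsProbabilityMeasure ρ₂] (h₁ : m ≤ ρ₁) (h₂ : m ≤ ρ₂) {ε : ℝ}
    (hm : 1 - ε ≤ m.real Set.univ) : tvNormSub ρ₁ ρ₂ ≤ ENNReal.ofReal (2 * ε) := by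
  have : IsFiniteMeasure m := isFiniteMeasure_of_le ρ₁ h₁
  refine iSup_le fun f => iSup_le fun hf => iSup_le fun hf1 => ENNReal.ofReal_le_ofReal ?_
  have key : ∀ (ρ : Measure E) [IsProbabilityMeasure ρ], m ≤ ρ →
      |∫ x, f x ∂ρ - ∫ x, f x ∂m| ≤ ε := by
    intro ρ _ hle
    have hint : ∀ (ν : Measure E) [IsFiniteMeasure ν], Integrable f ν := fun ν _ =>
      Integrable.of_bound hf.aestronglyMeasurable 1 (ae_of_all _ hf1)
    have e : ρ = (ρ - m) + m := (Measure.sub_add_cancel_of_le hle).symm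
    have hmass : (ρ - m).real Set.univ ≤ ε := by
      have h3 : ρ.real Set.univ = (ρ - m).real Set.univ + m.real Set.univ := by
        conv_lhs => rw [e]
        rw [measureReal_add_apply]
      rw [probReal_univ] at h3
      linarith
    have h4 : ∫ x, f x ∂ρ = ∫ x, f x ∂(ρ - m) + ∫ x, f x ∂m := by
      conv_lhs => rw [e]
      exact integral_add_measure (hint _) (hint _)
    rw [h4, add_sub_cancel_right]
    calc |∫ x, f x ∂(ρ - m)| ≤ 1 * (ρ - m).real Set.univ := by
          rw [← Real.norm_eq_abs]
          exact norm_integral_le_of_norm_le_const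
            (ae_of_all _ fun x => by rw [Real.norm_eq_abs]; exact hf1 x)
      _ ≤ ε := by rwa [one_mul]
  have k1 := abs_le.1 (key ρ₁ h₁)
  have k2 := abs_le.1 (key ρ₂ h₂)
  rw [abs_le]
  constructor <;> linarith

lemma eq_of_tvNormSub_eq_zero {E : Type*} [MeasurableSpace E] {ρ₁ ρ₂ : Measure E}
    [IsProbabilityMeasure ρ₁] [IsProbabilityMeasure ρ₂] (h : tvNormSub ρ₁ ρ₂ = 0) : ρ₁ = ρ₂ := by
  refine Measure.ext fun s hs => ?_
  have hle : ENNReal.ofReal |∫ x, s.indicator (1 : E → ℝ) x ∂ρ₁ - ∫ x, s.indicator 1 x ∂ρ₂| ≤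
      tvNormSub ρ₁ ρ₂ := by
    refine le_iSup_of_le (s.indicator 1) (le_iSup_of_le (measurable_one.indicator hs)
      (le_iSup_of_le ?_ le_rfl))
    intro x
    by_cases hx : x ∈ s <;> simp [hx]
  rw [h, integral_indicator_one hs, integral_indicator_one hs, nonpos_iff_eq_zero,
    ENNReal.ofReal_eq_zero, abs_nonpos_iff, sub_eq_zero] at hle
  exact (measureReal_eq_measureReal_iff).1 hle

/-! ### The stationary law and the common minorant -/

section Invariance

variable {E Ω : Type*} [TopologicalSpace E] [MeasurableSpace E] [MeasurableSpace Ω]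

/-- The occupation measure `∫_0^∞ E_μ[e^{-∫_0^r κ(Y_s) ds}; Y_r ∈ ·] dr` of a cycle. -/
noncomputable def occupation (Y : RightProcess E Ω) (κ : E → ℝ≥0) (μ : Measure E)
    [IsProbabilityMeasure μ] : Measure E :=
  (((volume.restrict (Set.Ici (0 : ℝ))).prod (Y.initLaw μ)).withDensity
    fun p => Y.survival κ p.1.toNNReal p.2).map fun p => Y.path p.1.toNNReal p.2

/-- The mean length of a cycle. -/
noncomputable def meanCycle (Y : RightProcess E Ω) (κ : E → ℝ≥0) (μ : Measure E)
    [IsProbabilityMeasure μ] : ℝ≥0∞ := ∫⁻ r in Set.Ici 0, survivalFn Y κ μ r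

/-- The normalised occupation measure of a cycle. -/
noncomputable def stationaryLaw (Y : RightProcess E Ω) (κ : E → ℝ≥0) (μ : Measure E)
    [IsProbabilityMeasure μ] : Measure E := (meanCycle Y κ μ)⁻¹ • occupation Y κ μ

variable [BorelSpace E]

lemma lintegral_occupation (Y : RightProcess E Ω) {κ : E → ℝ≥0} (hκ : Measurable κ)
    (μ : Measure E) [IsProbabilityMeasure μ] {ψ : E → ℝ≥0∞}
    (hψ : Measurable[universalCompletion E] ψ) :
    ∫⁻ x, ψ x ∂(occupation Y κ μ) = ∫⁻ r in Set.Ici (0 : ℝ),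
      ∫⁻ ω, ψ (Y.path r.toNNReal ω) * Y.survival κ r.toNNReal ω ∂(Y.initLaw μ) := by
  set P := (volume.restrict (Set.Ici (0 : ℝ))).prod (Y.initLaw μ) with hP
  have hpath : Measurable fun p : ℝ × Ω => Y.path p.1.toNNReal p.2 := Y.measurable_path.comp
    ((measurable_real_toNNReal.comp measurable_fst).prodMk measurable_snd)
  have hsurv : Measurable fun p : ℝ × Ω => Y.survival κ p.1.toNNReal p.2 :=
    (Y.measurable_survival hκ).comp
      ((measurable_real_toNNReal.comp measurable_fst).prodMk measurable_snd)
  -- Universal measurability refers to finite measures, whereas `P` is infinite; a finite measure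
  -- dominating `Q` is used instead.
  have haem : ∀ (Q : Measure (ℝ × Ω)) [SFinite Q],
      AEMeasurable (fun p => ψ (Y.path p.1.toNNReal p.2)) Q := by
    intro Q _
    exact ((aemeasurable_of_universal hψ (Q.toFinite.map fun p => Y.path p.1.toNNReal p.2))
      |>.comp_measurable hpath).mono_ac (absolutelyContinuous_toFinite Q)
  have haem2 : AEMeasurable ψ ((P.withDensity
      fun p => Y.survival κ p.1.toNNReal p.2).map fun p => Y.path p.1.toNNReal p.2) := by
    have : SFinite ((P.withDensity
      fun p => Y.survival κ p.1.toNNReal p.2).map fun p => Y.path p.1.toNNReal p.2) := inferInstance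
    exact (aemeasurable_of_universal hψ _).mono_ac (absolutelyContinuous_toFinite _)
  rw [occupation, lintegral_map' haem2 hpath.aemeasurable,
    lintegral_withDensity_eq_lintegral_mul₀ hsurv.aemeasurable (haem _)]
  simp only [Pi.mul_apply]
  rw [hP, lintegral_prod (fun p : ℝ × Ω => Y.survival κ p.1.toNNReal p.2 *
    ψ (Y.path p.1.toNNReal p.2)) (hsurv.aemeasurable.mul (haem P))]
  simp_rw [mul_comm]

lemma occupation_apply (Y : RightProcess E Ω) {κ : E → ℝ≥0} (hκ : Measurable κ)
    (μ : Measure E) [IsProbabilityMeasure μ] {B : Set E} (hB : MeasurableSet B) :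
    occupation Y κ μ B =
      ∫⁻ r in Set.Ici (0 : ℝ), Y.killed κ r.toNNReal B (Y.initLaw μ) := by
  rw [← lintegral_indicator_one hB, lintegral_occupation Y hκ μ]
  · rfl
  · exact fun s hs ν _ => (measurable_one.indicator hB hs).nullMeasurableSet

/-- Lifetimes are almost surely positive, so some level `1 / (n + 1)` is exceeded with positive
probability; this bounds the survival function from below up to that level. -/
lemma meanCycle_ne_zero (Y : RightProcess E Ω) {κ : E → ℝ≥0} (hκ : Measurable κ)
    (hκ' : IsLocallyBounded κ) (μ : Measure E) [IsProbabilityMeasure μ] :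
    meanCycle Y κ μ ≠ 0 := by
  have hex : ∃ n : ℕ, cycleLaw Y μ {p | ((1 / (n + 1) : ℝ≥0) : ℝ≥0∞) < lifetime Y κ p} ≠ 0 := by
    by_contra hcon
    push Not at hcon
    have h1 := measure_iUnion_null hcon
    have h2 : (⋃ n : ℕ, {p | ((1 / (n + 1) : ℝ≥0) : ℝ≥0∞) < lifetime Y κ p}) =
        {p | 0 < lifetime Y κ p} := by
      ext p
      simp only [Set.mem_iUnion, Set.mem_ofPred_eq]
      constructor
      · rintro ⟨n, hn⟩
        exact zero_le.trans_lt hn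
      · intro hp
        obtain ⟨r, hr, hr'⟩ := ENNReal.lt_iff_exists_nnreal_btwn.1 hp
        obtain ⟨n, hn⟩ := exists_nat_one_div_lt (K := ℝ≥0) (by exact_mod_cast hr : 0 < r)
        exact ⟨n, (ENNReal.coe_lt_coe.2 hn).trans hr'⟩
    rw [h2] at h1
    have h3 := ae_lifetime_pos Y hκ' μ
    obtain ⟨p, hp, hp'⟩ := (h3.and (measure_eq_zero_iff_ae_notMem.1 h1)).exists
    exact hp' hp
  obtain ⟨n, hn⟩ := hex
  have hle : ∫⁻ _ in Set.Icc (0 : ℝ) (1 / (n + 1) : ℝ≥0),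
      cycleLaw Y μ {p | ((1 / (n + 1) : ℝ≥0) : ℝ≥0∞) < lifetime Y κ p} ≤ meanCycle Y κ μ := by
    refine (setLIntegral_mono (measurable_survivalFn Y hκ μ) fun r hr => ?_).trans
      (lintegral_mono_set Set.Icc_subset_Ici_self)
    rw [survivalFn, ← cycleLaw_lt_lifetime Y hκ hκ']
    refine measure_mono fun p hp => ?_
    refine lt_of_le_of_lt (b := ((1 / (n + 1) : ℝ≥0) : ℝ≥0∞)) ?_ hp
    exact ENNReal.coe_le_coe.2 (Real.toNNReal_le_iff_le_coe.2 hr.2)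
  intro h0
  rw [h0, nonpos_iff_eq_zero, setLIntegral_const, mul_eq_zero] at hle
  rcases hle with h | h
  · exact hn h
  · simp at h
    have : (0 : ℝ) < (n + 1 : ℝ)⁻¹ := by positivity
    linarith

lemma meanCycle_ne_top {Y : RightProcess E Ω} {κ : E → ℝ≥0} {c : ℝ≥0}
    (h : RateBoundedBelow Y κ c) (hκ : Measurable κ) (hc : 0 < c) (μ : Measure E)
    [IsProbabilityMeasure μ] : meanCycle Y κ μ ≠ ⊤ := by
  have hc' : (0 : ℝ) < c := hc
  have := isProbabilityMeasure_expMeasure hc'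
  have h1 := lintegral_expMeasure_eq hc' (fun _ => 1) measurable_const
  simp only [lintegral_one, measure_univ, mul_one] at h1
  rw [lintegral_const_mul _ (measurable_expDensity c)] at h1
  have h2 : ∫⁻ r in Set.Ici 0, expDensity c r ≠ ⊤ := by
    intro htop
    rw [htop, ENNReal.mul_top (by simpa using hc.ne')] at h1
    exact ENNReal.one_ne_top h1
  refine ne_top_of_le_ne_top h2 (setLIntegral_mono (measurable_expDensity c) fun r hr => ?_)
  rw [survivalFn_eq h hκ μ r hr]
  exact mul_le_of_le_one_right' (survivalFn_le_one Y _ μ r)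

lemma isProbabilityMeasure_stationaryLaw {Y : RightProcess E Ω} {κ : E → ℝ≥0} {c : ℝ≥0}
    (h : RateBoundedBelow Y κ c) (hκ : Measurable κ) (hκ' : IsLocallyBounded κ) (hc : 0 < c)
    (μ : Measure E) [IsProbabilityMeasure μ] : IsProbabilityMeasure (stationaryLaw Y κ μ) := by
  refine ⟨?_⟩
  rw [stationaryLaw, Measure.smul_apply, occupation_apply Y hκ μ MeasurableSet.univ, smul_eq_mul]
  exact ENNReal.inv_mul_cancel (meanCycle_ne_zero Y hκ hκ' μ) (meanCycle_ne_top h hκ hc μ)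

lemma lintegral_Ici_comp_add (g : ℝ → ℝ≥0∞) {t : ℝ} :
    ∫⁻ r in Set.Ici 0, g (r + t) = ∫⁻ r in Set.Ici t, g r := by
  rw [← lintegral_indicator measurableSet_Ici, ← lintegral_indicator measurableSet_Ici,
    ← lintegral_add_right_eq_self ((Set.Ici t).indicator g) t]
  refine lintegral_congr fun r => ?_
  simp [Set.indicator_apply]

lemma lintegral_Icc_add_Ici (g : ℝ → ℝ≥0∞) {t : ℝ} (ht : 0 ≤ t) :
    (∫⁻ r in Set.Icc 0 t, g r) + ∫⁻ r in Set.Ici t, g r = ∫⁻ r in Set.Ici 0, g r := by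
  rw [← setLIntegral_congr (Ioi_ae_eq_Ici (a := t)), ← lintegral_union measurableSet_Ioi,
    Set.Icc_union_Ioi_eq_Ici ht]
  rw [Set.disjoint_left]
  intro x hx hx'
  exact absurd hx.2 (not_le.2 hx')

/-- By the semigroup property, running the killed process for time `t` from the occupation measure
gives the occupation after time `t`. -/
lemma killed_stationaryLaw (Y : RightProcess E Ω) {κ : E → ℝ≥0} (hκ : Measurable κ)
    (μ : Measure E) [IsProbabilityMeasure μ] [IsProbabilityMeasure (stationaryLaw Y κ μ)]
    {B : Set E} (hB : MeasurableSet B) (t : ℝ) (ht : 0 ≤ t) :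
    Y.killed κ t.toNNReal B (Y.initLaw (stationaryLaw Y κ μ)) =
      (meanCycle Y κ μ)⁻¹ *
        ∫⁻ r in Set.Ici t, Y.killed κ r.toNNReal B (Y.initLaw μ) := by
  rw [Y.killed_initLaw hκ hB, stationaryLaw, lintegral_smul_measure,
    lintegral_occupation Y hκ μ (Y.measurable_killed_law hκ hB _), smul_eq_mul,
    ← lintegral_Ici_comp_add fun r => Y.killed κ r.toNNReal B (Y.initLaw μ)]
  congr 1
  refine setLIntegral_congr_fun measurableSet_Ici fun r hr => ?_
  rw [← Y.killed_add hκ hB, Real.toNNReal_add hr ht]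

/-- In the renewal equation started from this law, the first cycle still alive contributes the
normalised occupation after `t`, and by `lintegral_survival_mul_eq` the regenerated part contributes
the occupation before `t`. The two add up to the full occupation measure. -/
lemma isInvariantDistribution_stationaryLaw {Y : RightProcess E Ω} {κ : E → ℝ≥0} {c : ℝ≥0}
    (h : RateBoundedBelow Y κ c) (hκ : Measurable κ) (hκ' : IsLocallyBounded κ) (hc : 0 < c)
    (μ : Measure E) [IsProbabilityMeasure μ] [IsProbabilityMeasure (stationaryLaw Y κ μ)] :
    IsInvariantDistribution Y κ μ (stationaryLaw Y κ μ) := by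
  have hM0 := meanCycle_ne_zero Y hκ hκ' μ
  have hMt := meanCycle_ne_top h hκ hc μ
  have hS := measurable_survivalFn Y hκ μ
  set M := meanCycle Y κ μ with hM
  -- The equilibrium law of renewal theory: from the stationary law, the first lifetime has density
  -- `P_μ(τ > r) / M`.
  have hlife : lifeLaw Y κ (stationaryLaw Y κ μ) =
      M⁻¹ • (volume.restrict (Set.Ici 0)).withDensity (survivalFn Y κ μ) := by
    refine eq_of_survival_eq (lifeLaw_Iio Y hκ hκ' _) ?_ (lifeLaw_Iic_add Y hκ hκ' _) ?_
    · rw [Measure.smul_apply, withDensity_apply _ measurableSet_Iio,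
        Measure.restrict_restrict measurableSet_Iio]
      have : Set.Iio (0 : ℝ) ∩ Set.Ici 0 = ∅ := by
        ext x; simp
      simp [this]
    · intro t ht
      rw [survivalFn, killed_stationaryLaw Y hκ μ MeasurableSet.univ t ht, Measure.smul_apply,
        withDensity_apply _ measurableSet_Iic, Measure.restrict_restrict measurableSet_Iic,
        smul_eq_mul, ← mul_add]
      have e : Set.Iic t ∩ Set.Ici 0 = Set.Icc 0 t := by
        ext x; simp [and_comm]
      rw [e]
      have := lintegral_Icc_add_Ici (survivalFn Y κ μ) ht
      simp only [survivalFn] at this ⊢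
      rw [this]
      exact ENNReal.inv_mul_cancel hM0 hMt
  intro t
  refine Measure.ext fun B hB => ?_
  have hg : Measurable fun r : ℝ => Y.killed κ r.toNNReal B (Y.initLaw μ) :=
    (Y.measurable_killed hκ hB _).comp measurable_real_toNNReal
  have hu := measurable_restoreFn Y hκ hκ' μ hB
  have hren : ∀ t, 0 ≤ t → restoreFn Y κ μ B t = Y.killed κ t.toNNReal B (Y.initLaw μ) +
      ∫⁻ s, restoreFn Y κ μ B (t - s) ∂(lifeLaw Y κ μ) := by
    intro t ht
    rw [← restoreLaw_renewal_lifeLaw Y hκ hκ' μ μ hB t ht, restoreFn,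
      Set.indicator_of_mem (Set.mem_Ici.2 ht)]
  have hid := lintegral_survival_mul_eq (lifeLaw_Iio Y hκ hκ' μ) (lifeLaw_Iic_add Y hκ hκ' μ) hu hg
    (restoreFn_of_neg Y κ μ B) (restoreFn_le_one Y hκ hκ' μ B) hren t
  have h1 := restoreLaw_renewal_lifeLaw Y hκ hκ' μ (stationaryLaw Y κ μ) hB t t.coe_nonneg
  rw [killed_stationaryLaw Y hκ μ hB _ t.coe_nonneg, hlife, lintegral_smul_measure,
    lintegral_withDensity_eq_lintegral_mul _ hS (g := fun s => restoreFn Y κ μ B (t - s))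
      (hu.comp (measurable_const_sub (t : ℝ))),
    Real.toNNReal_coe, smul_eq_mul] at h1
  simp only [Pi.mul_apply] at h1
  rw [h1, hid, stationaryLaw, Measure.smul_apply, occupation_apply Y hκ μ hB, smul_eq_mul,
    ← lintegral_Icc_add_Ici _ t.coe_nonneg, ← mul_add, add_comm]

/-- The law of the process at time `t`, started afresh from `μ` at the time of an independent
exponential clock, on the event that the clock rings before time `t`. -/
noncomputable def clockLaw (Y : RightProcess E Ω) (κ : E → ℝ≥0) (μ : Measure E)
    [IsProbabilityMeasure μ] (c : ℝ≥0) (t : ℝ≥0) : Measure E :=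
  (((expMeasure c).restrict (Set.Iic (t : ℝ))).prod (restoreMeasure Y μ μ)).map
    fun p => restorePath Y κ ((t : ℝ) - p.1).toNNReal p.2

lemma measurable_clockPath (Y : RightProcess E Ω) {κ : E → ℝ≥0} (hκ : Measurable κ)
    (hκ' : IsLocallyBounded κ) (t : ℝ≥0) :
    Measurable fun p : ℝ × CycleSpace Ω => restorePath Y κ ((t : ℝ) - p.1).toNNReal p.2 := by
  have h := Measurable.comp (g := fun p : ℝ≥0 × CycleSpace Ω => restorePath Y κ p.1 p.2)
    (f := fun p : ℝ × CycleSpace Ω => (((t : ℝ) - p.1).toNNReal, p.2))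
    (measurable_restorePath Y hκ hκ')
    ((measurable_real_toNNReal.comp (measurable_const.sub measurable_fst)).prodMk measurable_snd)
  simpa only [Function.comp_def] using h

lemma clockLaw_apply (Y : RightProcess E Ω) {κ : E → ℝ≥0} (hκ : Measurable κ)
    (hκ' : IsLocallyBounded κ) (μ : Measure E) [IsProbabilityMeasure μ] {c : ℝ≥0} (hc : 0 < c)
    (t : ℝ≥0) {B : Set E} (hB : MeasurableSet B) :
    clockLaw Y κ μ c t B = ∫⁻ s, restoreFn Y κ μ B (t - s) ∂(expMeasure c) := by
  have := isProbabilityMeasure_expMeasure (r := (c : ℝ)) hc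
  have hm := measurable_clockPath Y hκ hκ' t
  rw [clockLaw, Measure.map_apply hm hB, Measure.prod_apply (hm hB),
    ← lintegral_indicator measurableSet_Iic]
  refine lintegral_congr fun s => ?_
  by_cases hs : s ≤ t
  · have h2 : (t : ℝ) - s ∈ Set.Ici (0 : ℝ) := by simpa using hs
    rw [Set.indicator_of_mem (Set.mem_Iic.2 hs), restoreFn, Set.indicator_of_mem h2,
      restoreLaw_apply Y hκ hκ' μ μ _ hB]
    rfl
  · have h2 : (t : ℝ) - s ∉ Set.Ici (0 : ℝ) := by simpa using hs
    rw [Set.indicator_of_notMem (by simpa using hs), restoreFn, Set.indicator_of_notMem h2]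

lemma clockLaw_real_univ (Y : RightProcess E Ω) {κ : E → ℝ≥0} (hκ : Measurable κ)
    (hκ' : IsLocallyBounded κ) (μ : Measure E) [IsProbabilityMeasure μ] {c : ℝ≥0} (hc : 0 < c)
    (t : ℝ≥0) : (clockLaw Y κ μ c t).real Set.univ = 1 - Real.exp (-(t * c)) := by
  have hc' : (0 : ℝ) < c := hc
  have := isProbabilityMeasure_expMeasure hc'
  rw [measureReal_def, clockLaw, Measure.map_apply (measurable_clockPath Y hκ hκ' t)
    MeasurableSet.univ, Set.preimage_univ, ← Set.univ_prod_univ, Measure.prod_prod,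
    Measure.restrict_apply MeasurableSet.univ, Set.univ_inter, expMeasure_Iic hc',
    if_pos t.coe_nonneg, measure_univ, mul_one, ENNReal.toReal_ofReal, mul_comm]
  simp; positivity

lemma clockLaw_le {Y : RightProcess E Ω} {κ : E → ℝ≥0} {c : ℝ≥0}
    (h : RateBoundedBelow Y κ c) (hκ : Measurable κ) (hκ' : IsLocallyBounded κ) (hc : 0 < c)
    (μ ν : Measure E) [IsProbabilityMeasure μ] [IsProbabilityMeasure ν] (t : ℝ≥0) :
    clockLaw Y κ μ c t ≤ restoreLaw Y κ μ ν t := by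
  refine Measure.le_iff.2 fun B hB => ?_
  rw [clockLaw_apply Y hκ hκ' μ hc t hB]
  simpa using lintegral_restoreFn_le h hκ hκ' hc μ ν hB t t.coe_nonneg

end Invariance

end Restore

theorem mainTheorem4 {E Ω : Type*} [TopologicalSpace E] [MeasurableSpace E] [BorelSpace E]
    [MeasurableSpace Ω]
    (m : Measure E) [SigmaFinite m] [IsLocallyFiniteMeasure m] [m.InnerRegular]
    (Y : Restore.RightProcess E Ω)
    (κ : E → ℝ≥0) (hκ_meas : Measurable κ) (hκ_bdd : Restore.IsLocallyBounded κ)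
    (μ : Measure E) [IsProbabilityMeasure μ]
    (hirr : Restore.IsIrreducible Y κ μ)
    (κlow : ℝ≥0) (hκlow : 0 < κlow)
    (hκ_ae : ∀ᵐ x ∂m, κlow ≤ κ x)
    -- the exceptional set is not charged by the occupation measures of `Y`
    (hκ_path : ∀ x : E, ∀ᵐ ω ∂(Y.law x),
      ∀ᵐ s ∂(volume.restrict (Set.Ici (0 : ℝ))), κlow ≤ κ (Y.path s.toNNReal ω)) :
    ∃ (π : Measure E) (_ : IsProbabilityMeasure π),
      Restore.IsInvariantDistribution Y κ μ π ∧
      (∀ (π' : Measure E) [IsProbabilityMeasure π'],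
        Restore.IsInvariantDistribution Y κ μ π' → π' = π) ∧
      ∀ (ν : Measure E) [IsProbabilityMeasure ν] (t : ℝ≥0),
        Restore.tvNormSub (Restore.restoreLaw Y κ μ ν t) π
          ≤ ENNReal.ofReal (2 * Real.exp (-(t * κlow))) := by
  have hπ := Restore.isProbabilityMeasure_stationaryLaw hκ_path hκ_meas hκ_bdd hκlow μ
  have hinv := Restore.isInvariantDistribution_stationaryLaw hκ_path hκ_meas hκ_bdd hκlow μ
  have htv : ∀ (ν : Measure E) [IsProbabilityMeasure ν] (t : ℝ≥0),
      Restore.tvNormSub (Restore.restoreLaw Y κ μ ν t) (Restore.stationaryLaw Y κ μ)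
        ≤ ENNReal.ofReal (2 * Real.exp (-(t * κlow))) := by
    intro ν _ t
    have := Restore.isProbabilityMeasure_restoreLaw Y hκ_meas hκ_bdd μ ν t
    -- Started from the stationary law, the minorant lies below that law itself, by invariance.
    have h2 := Restore.clockLaw_le hκ_path hκ_meas hκ_bdd hκlow μ (Restore.stationaryLaw Y κ μ) t
    rw [hinv t] at h2
    exact Restore.tvNormSub_le_of_le (Restore.clockLaw_le hκ_path hκ_meas hκ_bdd hκlow μ ν t) h2
      (Restore.clockLaw_real_univ Y hκ_meas hκ_bdd μ hκlow t).ge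
  refine ⟨Restore.stationaryLaw Y κ μ, hπ, hinv, fun π' _ hπ' => ?_, htv⟩
  refine Restore.eq_of_tvNormSub_eq_zero (le_antisymm ?_ zero_le)
  -- An invariant `π'` is its own law at every integer time, so its distance to the stationary law
  -- is below a sequence tending to zero.
  have hlim : Tendsto (fun n : ℕ => ENNReal.ofReal (2 * Real.exp (-(n * κlow)))) atTop (𝓝 0) := by
    have h1 : Tendsto (fun n : ℕ => (n : ℝ) * κlow) atTop atTop :=
      tendsto_natCast_atTop_atTop.atTop_mul_const (by exact_mod_cast hκlow)
    have h2 := (Real.tendsto_exp_neg_atTop_nhds_zero.comp h1).const_mul 2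
    have h3 := ENNReal.tendsto_ofReal h2
    simpa using h3
  refine ge_of_tendsto' hlim fun n => ?_
  have := htv π' n
  rw [hπ' n] at this
  simpa using this
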